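/- Let $M,N\ge 1$ be integers. Consider three transmitters with $M$ antennas each and three receivers with $N$ antennas each. In channel use $t$, receiver $j\in\{1,2,3\}$ observes $$\mathbf y_j(t)=\sum_{i=1}^{3}\mathbf H_{ji}\,\mathbf x_i(t)+\mathbf n_j(t)\in\mathbb C^{N},$$ where $\mathbf x_i(t)\in\mathbb C^M$ is the signal of transmitter $i$, subject to $\|\mathbf x_i(t)\|^2\le P$, and the entries of the noise are independent circularly symmetric complex Gaussian variables of mean $0$ and variance $1$. The channel matrices $\mathbf H_{ji}\in\mathbb C^{N\times M}$ have independent identically distributed entries with a continuous (atomless) law on $\mathbb C$, do not change with $t$, and are known to all transmitters and receivers. In the $3\times3$ partially cooperative MIMO X channel, each of the three pairs $\{p,q\}$ of transmitters has an independent uniformly distributed message $W_{k,pq}$ for each receiver $k$ (nine messages); transmitter $i$ knows exactly the messages of the two pairs that contain $i$, and receiver $k$ has to decode $W_{k,12},W_{k,13},W_{k,23}$. Rates (in bits per channel use) are achievable at power $P$ if there are codes of these rates, for all sufficiently large block lengths, whose error probabilities tend to $0$. A DoF per user of $d$ is achievable if, as $P\to\infty$, every one of the nine messages can be sent at an achievable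 rate $\frac d3\log_2P+o(\log P)$ (so that each receiver gets $d\log_2 P+o(\log P)$ in total). Put $$d_{02}=\begin{cases}N, & N/M\in(0,\tfrac23],\\[2pt] \tfrac{2M}{3}, & N/M\in(\tfrac23,\tfrac53],\\[2pt] \tfrac{2N}{5}, & N/M\in(\tfrac53,\tfrac52],\\[2pt] M, & N/M\in(\tfrac52,\infty).\end{cases}$$ (a) For almost all channel realizations, the DoF per user $d_{02}$ is achievable. (b) It is attained by linear interference neutralization in three phases with finite symbol extensions: there are integers $n\ge1$ and $s\ge 0$, depending only on $M$ and $N$, with $s/n=d_{02}$, such that for almost all channel realizations the following holds. There are three phases, in each of which the three transmitter pairs serve the three receivers bijectively, and which together serve each of the nine messages exactly once, such that for each phase there are precoding matrices $\mathbf V_{k,i}\in\mathbb C^{nM\times s}$ ($k\in\{1,2,3\}$, $i$ in the pair serving receiver $k$; $\mathbf V_{k,i}=0$ for the other $i$) and combining matrices $\mathbf Q_j\in\mathbb C^{s\times nN}$ with $$\mathbf Q_j\sum_{i}(\mathbf I_n\otimes\mathbf H_{ji})\mathbf V_{k,i}=0\quad(k\ne j),\qquad \mathbf Q_j\sum_{i}(\mathbf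 I_n\otimes\mathbf H_{ji})\mathbf V_{j,i}\ \text{ invertible}.$$ -/

import Mathlib

open MeasureTheory ProbabilityTheory Filter Topology
open scoped Matrix Kronecker

namespace CoopX

/-- The channel matrices: `H j i` is the `N × M` matrix from transmitter `i` (with `M` antennas)
to receiver `j` (with `N` antennas). -/
abbrev Channel (M N : ℕ) : Type := Fin 3 → Fin 3 → Matrix (Fin N) (Fin M) ℂ

/-- The channel whose coefficients are listed by `h`. -/
def channelOf {M N : ℕ} (h : Fin 3 × Fin 3 × Fin N × Fin M → ℂ) : Channel M N :=
  fun j i => Matrix.of fun a b => h (j, i, a, b)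

/-- The law of the channel coefficients when they are independent with common law `μ`. -/
noncomputable def channelLaw (M N : ℕ) (μ : Measure ℂ) :
    Measure (Fin 3 × Fin 3 × Fin N × Fin M → ℂ) :=
  Measure.pi fun _ => μ

/-- The circularly symmetric complex Gaussian law with mean `0` and variance `1`: real and
imaginary part are independent real Gaussians with mean `0` and variance `1 / 2`. -/
noncomputable def complexGaussian : Measure ℂ :=
  ((gaussianReal 0 (1 / 2)).prod (gaussianReal 0 (1 / 2))).map Complex.measurableEquivRealProd.symm

/-- The law of the noise at one receiver during `T` channel uses. -/
noncomputable def noiseLaw (N T : ℕ) : Measure (Fin T → Fin N → ℂ) :=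
  Measure.pi fun _ => Measure.pi fun _ => complexGaussian

instance : IsProbabilityMeasure complexGaussian :=
  Measure.isProbabilityMeasure_map Complex.measurableEquivRealProd.symm.measurable.aemeasurable

instance (N T : ℕ) : IsProbabilityMeasure (noiseLaw N T) := by
  unfold noiseLaw; infer_instance

/-- A list of messages. The cooperation groups are the three pairs of transmitters; group `g`
consists of the two transmitters other than `g`. The message `w k g` is to be sent by group `g` to
receiver `k` and takes `K k g` values. -/
abbrev Messages (K : Fin 3 → Fin 3 → ℕ) : Type := (k : Fin 3) → (g : Fin 3) → Fin (K k g)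

/-- A code of block length `T` and power `P` for the partially cooperative X channel. -/
structure Code (M N T : ℕ) (P : ℝ) where
  /-- number of values of each message -/
  K : Fin 3 → Fin 3 → ℕ
  K_pos : ∀ k g, 0 < K k g
  /-- the signal of transmitter `i` in each channel use -/
  enc : Fin 3 → Messages K → Fin T → Fin M → ℂ
  /-- transmitter `i` knows exactly the messages of the groups that contain it -/
  enc_local : ∀ (i : Fin 3) (w w' : Messages K),
    (∀ k g, g ≠ i → w k g = w' k g) → enc i w = enc i w'
  power : ∀ i w t, ∑ m, ‖enc i w t m‖ ^ 2 ≤ P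
  /-- receiver `k` estimates its three messages from its received signals -/
  dec : (k : Fin 3) → (Fin T → Fin N → ℂ) → (g : Fin 3) → Fin (K k g)
  dec_measurable : ∀ k, Measurable (dec k)



/-- The signal received by receiver `j` when the messages are `w` and the noise is `z`. -/
noncomputable def Code.output {M N T : ℕ} {P : ℝ} (C : Code M N T P) (H : Channel M N)
    (w : Messages C.K) (j : Fin 3) (z : Fin T → Fin N → ℂ) : Fin T → Fin N → ℂ :=
  fun t => (∑ i, H j i *ᵥ C.enc i w t) + z t

/-- The probability that receiver `j` gets one of its messages wrong, when all messages are
independent and uniformly distributed. -/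
noncomputable def Code.errorProb {M N T : ℕ} {P : ℝ} (C : Code M N T P) (H : Channel M N)
    (j : Fin 3) : ℝ :=
  (∑ w : Messages C.K, (noiseLaw N T).real {z | C.dec j (C.output H w j z) ≠ w j}) /
    Fintype.card (Messages C.K)

/-- The rates `R k g` (in bits per channel use) of the messages are achievable at power `P`: there
are codes, one for each large block length, with these rates and error probability tending
to `0`. -/
def IsAchievableRate {M N : ℕ} (H : Channel M N) (P : ℝ) (R : Fin 3 → Fin 3 → ℝ) : Prop :=
  ∀ ε : ℝ, 0 < ε → ∃ T₀ : ℕ, ∀ T : ℕ, T₀ ≤ T → ∃ C : Code M N T P,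
    (∀ k g, (2 : ℝ) ^ ((T : ℝ) * R k g) ≤ C.K k g) ∧ ∀ j, C.errorProb H j ≤ ε

/-- The degrees of freedom `δ k g` of the messages are achievable: at high power `P` one can
transmit each message at a rate `δ k g * log P + o(log P)`. -/
def IsAchievableDoF {M N : ℕ} (H : Channel M N) (δ : Fin 3 → Fin 3 → ℝ) : Prop :=
  ∃ R : ℝ → Fin 3 → Fin 3 → ℝ,
    (∀ᶠ P in atTop, IsAchievableRate H P (R P)) ∧
    ∀ k g, Tendsto (fun P => R P k g / Real.logb 2 P) atTop (𝓝 (δ k g))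

/-- `d` degrees of freedom per user are achievable, shared equally by the three messages
that the user wants. -/
def IsAchievableDoFPerUser {M N : ℕ} (H : Channel M N) (d : ℝ) : Prop :=
  IsAchievableDoF H fun _ _ => d / 3

/-- The channel matrix of `n` consecutive channel uses, the channel being constant. -/
noncomputable def extend {M N : ℕ} (n : ℕ) (A : Matrix (Fin N) (Fin M) ℂ) :
    Matrix (Fin n × Fin N) (Fin n × Fin M) ℂ :=
  (1 : Matrix (Fin n) (Fin n) ℂ) ⊗ₖ A

/-- One phase of linear interference neutralization over `n` channel uses. Receiver `k` is served
by group `σ k`, with `s` data streams. `V k i` is the precoding matrix of these streams at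
transmitter `i`; it vanishes if `i` is not in the group. `Q j` is the combining matrix of
receiver `j`. After combining, the contributions of the two transmitters to each interfering signal
cancel, and the desired streams are seen through an invertible matrix. -/
def NeutralizingPhase {M N : ℕ} (H : Channel M N) (n s : ℕ) (σ : Equiv.Perm (Fin 3)) : Prop :=
  ∃ (V : Fin 3 → Fin 3 → Matrix (Fin n × Fin M) (Fin s) ℂ)
    (Q : Fin 3 → Matrix (Fin s) (Fin n × Fin N) ℂ),
    (∀ k, V k (σ k) = 0) ∧
    (∀ j k, k ≠ j → Q j * ∑ i, extend n (H j i) * V k i = 0) ∧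
    ∀ j, IsUnit (Q j * ∑ i, extend n (H j i) * V j i)

/-- Three neutralizing phases which together serve each of the nine messages exactly once. -/
def ThreePhaseNeutralization {M N : ℕ} (H : Channel M N) (n s : ℕ) : Prop :=
  ∃ σ : Fin 3 → Equiv.Perm (Fin 3),
    (∀ k, Function.Bijective fun φ => σ φ k) ∧ ∀ φ, NeutralizingPhase H n s (σ φ)

/-- The degrees of freedom per user in terms of the numbers of antennas. -/
noncomputable def d02 (M N : ℕ) : ℝ :=
  if (N : ℝ) / M ≤ 2 / 3 then N
  else if (N : ℝ) / M ≤ 5 / 3 then 2 * M / 3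
  else if (N : ℝ) / M ≤ 5 / 2 then 2 * N / 5
  else M

end CoopX

namespace CoopX

/-! Neutralization is a generic property. A nonzero polynomial vanishes only on a null set of
channels when the coefficients are independent with an atomless law (`ae_ne_zero_of_mem_polyFun`).
It therefore suffices to exhibit one channel satisfying a condition that survives wherever some
polynomial is nonzero and that implies neutralization. Both conditions used are additive under block
diagonal sums of channels and, by repeating the channel, under concatenation in time, so a few
explicit small channels generate all the ratios `N / M` that are needed.

Up to `N / M = 5 / 3` the condition is `PairwiseControllable`: for fixed combining matrices, every
pair of transmitters can produce arbitrary combined signals at all three receivers, hence any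
desired signal with zero interference. Counting dimensions, `s ≤ n * N` and `3 * s ≤ 2 * n * M`; the
generating channels are `two_one`, `three_two` and `one_one`.

From `5 / 3` to `3` the condition is `Alignable`: at each receiver, `r` streams of one interfering
message coincide up to sign with `r` streams of the other. The `3 * (2 * r + f)` streams then span
`5 * r + 3 * f` dimensions, and the desired ones stay independent of the interference. The
generating channels are `one_three`, `two_five` and `one_two`. Beyond `3` each receiver separates
all transmit antennas.

For the degrees of freedom, three phases in succession form a `LinearScheme`, which turns the
channel into parallel interference-free links with bounded noise amplification. Square
constellations of about `P ^ (1 - 1 / a)` points per stream are sent on these links. At high power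
rounding rarely fails, and a Gilbert–Varshamov outer code corrects a fraction of about `1 / a` of
wrong blocks (`LinearScheme.exists_code`). At a fixed large power the error decays exponentially in
the block length; letting `a` grow costs arbitrarily little rate, and a diagonal argument reaches
the limit. -/

/-! ### Polynomial functions and their null zero sets -/

/-- The algebra of polynomial functions in the variables `I`. -/
noncomputable def polyFun (I : Type*) : Subalgebra ℂ ((I → ℂ) → ℂ) :=
  Algebra.adjoin ℂ (Set.range fun (i : I) (h : I → ℂ) => h i)

theorem coord_mem_polyFun {I : Type*} (i : I) : (fun h : I → ℂ => h i) ∈ polyFun I :=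
  Algebra.subset_adjoin ⟨i, rfl⟩

theorem const_mem_polyFun {I : Type*} (c : ℂ) : (fun _ : I → ℂ => c) ∈ polyFun I :=
  (polyFun I).algebraMap_mem c

theorem exists_eval_of_mem_polyFun {I : Type*} {f : (I → ℂ) → ℂ} (hf : f ∈ polyFun I) :
    ∃ p : MvPolynomial I ℂ, ∀ h, f h = MvPolynomial.eval h p := by
  induction hf using Algebra.adjoin_induction with
  | mem x hx =>
    obtain ⟨i, rfl⟩ := hx
    exact ⟨MvPolynomial.X i, fun h => by simp⟩
  | algebraMap r => exact ⟨MvPolynomial.C r, fun h => by simp⟩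
  | add x y _ _ hx hy =>
    obtain ⟨p, hp⟩ := hx
    obtain ⟨q, hq⟩ := hy
    exact ⟨p + q, fun h => by simp [hp, hq]⟩
  | mul x y _ _ hx hy =>
    obtain ⟨p, hp⟩ := hx
    obtain ⟨q, hq⟩ := hy
    exact ⟨p * q, fun h => by simp [hp, hq]⟩

/-- Fubini and induction on the number of variables: regarded as a polynomial in the first variable
over the ring of polynomials in the others, `p` has finitely many constant roots. These are
negligible because `μ` has no atoms, and every other value of the first variable leaves a nonzero
polynomial. -/
theorem ae_eval_ne_zero_fin (μ : Measure ℂ) [IsProbabilityMeasure μ] [NullSingletonClass μ] :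
    ∀ (n : ℕ) (p : MvPolynomial (Fin n) ℂ), p ≠ 0 →
      ∀ᵐ h ∂(Measure.pi fun _ : Fin n => μ), MvPolynomial.eval h p ≠ 0 := by
  intro n
  induction n with
  | zero =>
    intro p hp
    refine Filter.Eventually.of_forall fun h => ?_
    rw [MvPolynomial.eq_C_of_isEmpty p] at hp ⊢
    simpa using hp
  | succ n ih =>
    intro p hp
    have hmp := measurePreserving_piFinSuccAbove (fun _ : Fin (n + 1) => μ) 0
    set e := MeasurableEquiv.piFinSuccAbove (fun _ : Fin (n + 1) => ℂ) 0 with he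
    have hfin : {a : ℂ | (MvPolynomial.finSuccEquiv ℂ n p).eval (MvPolynomial.C a) = 0}.Finite := by
      have hne : MvPolynomial.finSuccEquiv ℂ n p ≠ 0 := by simpa using hp
      refine ((Polynomial.finite_setOfPred_isRoot hne).preimage
        ((MvPolynomial.C_injective (Fin n) ℂ).injOn)).subset ?_
      intro a ha
      exact ha
    have heval : ∀ (a : ℂ) (t : Fin n → ℂ), MvPolynomial.eval (e.symm (a, t)) p =
        MvPolynomial.eval t ((MvPolynomial.finSuccEquiv ℂ n p).eval (MvPolynomial.C a)) := by
      intro a t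
      have : e.symm (a, t) = Fin.cons a t := by
        simp [he, MeasurableEquiv.piFinSuccAbove, Fin.insertNthEquiv]
      rw [this, MvPolynomial.eval_eq_eval_mv_eval', Polynomial.eval_map, Polynomial.eval,
        Polynomial.hom_eval₂]
      simp
    have hmeas : MeasurableSet {h : Fin (n + 1) → ℂ | MvPolynomial.eval h p = 0} :=
      (isClosed_eq (MvPolynomial.continuous_eval p) continuous_const).measurableSet
    have key : (μ.prod (Measure.pi fun _ : Fin n => μ))
        (e.symm ⁻¹' {h | MvPolynomial.eval h p = 0}) = 0 := by
      rw [Measure.measure_prod_null (e.symm.measurable hmeas)]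
      filter_upwards [measure_eq_zero_iff_ae_notMem.1 (hfin.measure_zero μ)] with a ha
      have := ih _ ha
      rw [ae_iff] at this
      simpa [Set.preimage, heval] using this
    rw [ae_iff]
    have h1 := hmp.measure_preimage (e.symm.measurable hmeas).nullMeasurableSet
    rw [key] at h1
    simpa [Set.preimage] using h1

/-- A nonzero polynomial function does not vanish almost everywhere, for a product of atomless
laws. -/
theorem ae_ne_zero_of_mem_polyFun {I : Type*} [Fintype I] (μ : Measure ℂ) [IsProbabilityMeasure μ]
    [NullSingletonClass μ] {f : (I → ℂ) → ℂ} (hf : f ∈ polyFun I) {h₀ : I → ℂ} (h0 : f h₀ ≠ 0) :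
    ∀ᵐ h ∂(Measure.pi fun _ : I => μ), f h ≠ 0 := by
  classical
  obtain ⟨p, hp⟩ := exists_eval_of_mem_polyFun hf
  let e := Fintype.equivFin I
  have hne : MvPolynomial.rename e p ≠ 0 := by
    intro h
    have : p = 0 := MvPolynomial.rename_injective e e.injective (by simpa using h)
    exact h0 (by simp [hp, this])
  have h1 := ae_eval_ne_zero_fin μ _ _ hne
  have hmp := measurePreserving_piCongrLeft (fun _ : Fin (Fintype.card I) => μ) e
  have h2 := hmp.quasiMeasurePreserving.ae h1
  filter_upwards [h2] with h hh
  rw [MvPolynomial.eval_rename] at hh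
  rw [hp]
  convert hh using 3
  ext i
  simp [MeasurableEquiv.coe_piCongrLeft]

/-- Matrices whose entries are polynomial functions. -/
def PolyMat {I m n : Type*} (A : (I → ℂ) → Matrix m n ℂ) : Prop :=
  ∀ a b, (fun h => A h a b) ∈ polyFun I

namespace PolyMat

variable {I l m n o : Type*}

theorem const (A : Matrix m n ℂ) : PolyMat fun _ : I → ℂ => A :=
  fun a b => const_mem_polyFun (A a b)

theorem add {A B : (I → ℂ) → Matrix m n ℂ} (hA : PolyMat A) (hB : PolyMat B) :
    PolyMat fun h => A h + B h :=
  fun a b => (polyFun I).add_mem (hA a b) (hB a b)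

theorem sub {A B : (I → ℂ) → Matrix m n ℂ} (hA : PolyMat A) (hB : PolyMat B) :
    PolyMat fun h => A h - B h :=
  fun a b => (polyFun I).sub_mem (hA a b) (hB a b)

theorem smul {f : (I → ℂ) → ℂ} {A : (I → ℂ) → Matrix m n ℂ} (hf : f ∈ polyFun I)
    (hA : PolyMat A) : PolyMat fun h => f h • A h :=
  fun a b => (polyFun I).mul_mem hf (hA a b)

theorem sum {ι : Type*} {s : Finset ι} {A : ι → (I → ℂ) → Matrix m n ℂ}
    (hA : ∀ i, PolyMat (A i)) : PolyMat fun h => ∑ i ∈ s, A i h := by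
  intro a b
  have := (polyFun I).sum_mem (t := s) fun i _ => hA i a b
  convert this using 1
  ext h
  simp [Matrix.sum_apply]

theorem mul [Fintype m] {A : (I → ℂ) → Matrix l m ℂ} {B : (I → ℂ) → Matrix m n ℂ}
    (hA : PolyMat A) (hB : PolyMat B) : PolyMat fun h => A h * B h := by
  intro a b
  have := (polyFun I).sum_mem (t := Finset.univ) fun i _ => (polyFun I).mul_mem (hA a i) (hB i b)
  convert this using 1
  ext h
  simp [Matrix.mul_apply]

theorem det [Fintype m] [DecidableEq m] {A : (I → ℂ) → Matrix m m ℂ} (hA : PolyMat A) :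
    (fun h => (A h).det) ∈ polyFun I := by
  have := (polyFun I).sum_mem (t := Finset.univ) fun (σ : Equiv.Perm m) _ =>
    (polyFun I).mul_mem (const_mem_polyFun ((Equiv.Perm.sign σ : ℤ) : ℂ))
      ((polyFun I).prod_mem (t := Finset.univ) fun i _ => hA (σ i) i)
  convert this using 1
  ext h
  simp [Matrix.det_apply']

theorem adjugate [Fintype m] [DecidableEq m] {A : (I → ℂ) → Matrix m m ℂ} (hA : PolyMat A) :
    PolyMat fun h => (A h).adjugate := by
  intro a b
  simp only [Matrix.adjugate_apply]
  refine det fun c d => ?_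
  by_cases hc : c = b
  · subst hc
    simpa using const_mem_polyFun _
  · simpa [Matrix.updateRow_ne hc] using hA c d

end PolyMat

theorem polyMat_channel (M N : ℕ) (j i : Fin 3) :
    PolyMat fun h : Fin 3 × Fin 3 × Fin N × Fin M → ℂ => channelOf h j i :=
  fun a b => coord_mem_polyFun (j, i, a, b)

theorem polyMat_extend {I : Type*} {M N : ℕ} (n : ℕ) {A : (I → ℂ) → Matrix (Fin N) (Fin M) ℂ}
    (hA : PolyMat A) : PolyMat fun h => extend n (A h) := by
  intro a b
  exact (polyFun I).mul_mem (const_mem_polyFun ((1 : Matrix (Fin n) (Fin n) ℂ) a.1 b.1))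
    (hA a.2 b.2)

/-! ### Left inverses and combining matrices -/

section LinearAlgebra

variable {m n o : Type*} [Fintype m] [Fintype n] [Fintype o]

theorem exists_left_inverse_matrix [DecidableEq n] (A : Matrix m n ℂ)
    (hA : ∀ v, A *ᵥ v = 0 → v = 0) : ∃ L : Matrix n m ℂ, L * A = 1 := by
  classical
  obtain ⟨g, hg⟩ := LinearMap.exists_leftInverse_of_injective (Matrix.toLin' A)
    (LinearMap.ker_eq_bot'.2 fun v hv => hA v (by simpa using hv))
  refine ⟨LinearMap.toMatrix' g, ?_⟩
  have := congrArg LinearMap.toMatrix' hg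
  rwa [LinearMap.toMatrix'_comp, LinearMap.toMatrix'_toLin', LinearMap.toMatrix'_id] at this

/-- If the columns of `D` are independent modulo the columns of `E`, some matrix inverts `D` and
annihilates `E`. -/
theorem exists_combining_matrix [DecidableEq n] (D : Matrix m n ℂ) (E : Matrix m o ℂ)
    (h : ∀ c d, D *ᵥ c + E *ᵥ d = 0 → c = 0) : ∃ Q : Matrix n m ℂ, Q * D = 1 ∧ Q * E = 0 := by
  classical
  let W := LinearMap.range (Matrix.toLin' E)
  obtain ⟨g, hg⟩ := LinearMap.exists_leftInverse_of_injective (W.mkQ ∘ₗ Matrix.toLin' D) (by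
    refine LinearMap.ker_eq_bot'.2 fun c hc => ?_
    simp only [LinearMap.comp_apply, Submodule.mkQ_apply, Submodule.Quotient.mk_eq_zero] at hc
    obtain ⟨d, hd⟩ := hc
    refine h c (-d) ?_
    rw [Matrix.toLin'_apply, Matrix.toLin'_apply] at hd
    rw [Matrix.mulVec_neg, hd, add_neg_cancel])
  refine ⟨LinearMap.toMatrix' (g ∘ₗ W.mkQ), ?_, ?_⟩
  · have := congrArg LinearMap.toMatrix' hg
    rwa [← LinearMap.comp_assoc, LinearMap.toMatrix'_comp, LinearMap.toMatrix'_toLin',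
      LinearMap.toMatrix'_id] at this
  · have h0 : (g ∘ₗ W.mkQ) ∘ₗ Matrix.toLin' E = 0 := by
      rw [LinearMap.comp_assoc, LinearMap.range_mkQ_comp, LinearMap.comp_zero]
    have := congrArg LinearMap.toMatrix' h0
    rwa [LinearMap.toMatrix'_comp, LinearMap.toMatrix'_toLin', map_zero] at this

end LinearAlgebra

/-! ### Block sums and time extensions of channels -/

/-- The block diagonal sum of two channels. -/
def blockSum {X Y X' Y' : Type*} (H : Fin 3 → Fin 3 → Matrix Y X ℂ)
    (H' : Fin 3 → Fin 3 → Matrix Y' X' ℂ) : Fin 3 → Fin 3 → Matrix (Y ⊕ Y') (X ⊕ X') ℂ :=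
  fun j i => Matrix.fromBlocks (H j i) 0 0 (H' j i)

/-- Renumbering the antennas of a channel. -/
def reindexed {X Y X' Y' : Type*} (e : Y' ≃ Y) (e' : X' ≃ X)
    (H : Fin 3 → Fin 3 → Matrix Y X ℂ) : Fin 3 → Fin 3 → Matrix Y' X' ℂ :=
  fun j i => (H j i).submatrix e e'

/-- All matrices of a channel, extended over `n` channel uses. -/
noncomputable def extended {M N : ℕ} (n : ℕ) (H : Channel M N) :
    Fin 3 → Fin 3 → Matrix (Fin n × Fin N) (Fin n × Fin M) ℂ :=
  fun j i => extend n (H j i)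

/-- The block diagonal sum of two channels with numbered antennas. -/
def Channel.sum {M N M' N' : ℕ} (H : Channel M N) (H' : Channel M' N') :
    Channel (M + M') (N + N') :=
  reindexed finSumFinEquiv.symm finSumFinEquiv.symm (blockSum H H')

theorem extended_sum {M N M' N' : ℕ} (n : ℕ) (H : Channel M N) (H' : Channel M' N') :
    extended n (H.sum H') =
      reindexed ((Equiv.prodCongrRight fun _ => finSumFinEquiv.symm).trans
          (Equiv.prodSumDistrib _ _ _))
        ((Equiv.prodCongrRight fun _ => finSumFinEquiv.symm).trans (Equiv.prodSumDistrib _ _ _))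
        (blockSum (extended n H) (extended n H')) := by
  funext j i
  ext ⟨t, a⟩ ⟨t', b⟩
  refine Fin.addCases (fun a => ?_) (fun a => ?_) a <;>
  refine Fin.addCases (fun b => ?_) (fun b => ?_) b <;>
  simp [extended, extend, Channel.sum, reindexed, blockSum]

theorem extended_add {M N : ℕ} (n n' : ℕ) (H : Channel M N) :
    extended (n + n') H =
      reindexed ((Equiv.prodCongrLeft fun _ => finSumFinEquiv.symm).trans
          (Equiv.sumProdDistrib _ _ _))
        ((Equiv.prodCongrLeft fun _ => finSumFinEquiv.symm).trans (Equiv.sumProdDistrib _ _ _))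
        (blockSum (extended n H) (extended n' H)) := by
  funext j i
  ext ⟨t, a⟩ ⟨t', b⟩
  refine Fin.addCases (fun t => ?_) (fun t => ?_) t <;>
  refine Fin.addCases (fun t' => ?_) (fun t' => ?_) t' <;>
  simp [extended, extend, reindexed, blockSum, Matrix.one_apply, Fin.ext_iff] <;>
  intro h <;> omega

/-! ### Neutralization by controlling all receivers -/

/-- Linear interference neutralization for arbitrary index types. -/
def Neutralizes {X Y : Type*} [Fintype X] [Fintype Y] (H : Fin 3 → Fin 3 → Matrix Y X ℂ)
    (S : Type*) [Fintype S] [DecidableEq S] (σ : Equiv.Perm (Fin 3)) : Prop :=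
  ∃ (V : Fin 3 → Fin 3 → Matrix X S ℂ) (Q : Fin 3 → Matrix S Y ℂ),
    (∀ k, V k (σ k) = 0) ∧ (∀ j k, k ≠ j → Q j * ∑ i, H j i * V k i = 0) ∧
    ∀ j, IsUnit (Q j * ∑ i, H j i * V j i)

/-- With suitable combining matrices, every pair of transmitters controls all the combined signals
of the three receivers. The two transmitters of the pair are those other than `g`. -/
def PairwiseControllable {X Y : Type*} [Fintype X] [Fintype Y]
    (H : Fin 3 → Fin 3 → Matrix Y X ℂ) (S : Type*) [Fintype S] : Prop :=
  ∃ Q : Fin 3 → Matrix S Y ℂ, ∀ (g : Fin 3) (a : Fin 3 → S → ℂ),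
    (∀ i, i ≠ g → ∑ j, a j ᵥ* (Q j * H j i) = 0) → a = 0

section PairwiseControllable

variable {X Y X' Y' S S' : Type*} [Fintype X] [Fintype Y] [Fintype X'] [Fintype Y'] [Fintype S]
  [Fintype S']

theorem PairwiseControllable.blockSum {H : Fin 3 → Fin 3 → Matrix Y X ℂ}
    {H' : Fin 3 → Fin 3 → Matrix Y' X' ℂ} (h : PairwiseControllable H S)
    (h' : PairwiseControllable H' S') : PairwiseControllable (blockSum H H') (S ⊕ S') := by
  obtain ⟨Q, hQ⟩ := h
  obtain ⟨Q', hQ'⟩ := h'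
  refine ⟨fun j => Matrix.fromBlocks (Q j) 0 0 (Q' j), fun g a ha => ?_⟩
  have key : ∀ i, ∑ j, a j ᵥ* (Matrix.fromBlocks (Q j) 0 0 (Q' j) * CoopX.blockSum H H' j i) =
      Sum.elim (∑ j, (a j ∘ Sum.inl) ᵥ* (Q j * H j i))
        (∑ j, (a j ∘ Sum.inr) ᵥ* (Q' j * H' j i)) := by
    intro i
    ext x
    cases x <;>
    simp [CoopX.blockSum, Matrix.fromBlocks_multiply, Matrix.vecMul_fromBlocks]
  have h1 := hQ g (fun j => a j ∘ Sum.inl) fun i hi => by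
    have := ha i hi
    rw [key] at this
    ext x
    simpa using congrFun this (Sum.inl x)
  have h2 := hQ' g (fun j => a j ∘ Sum.inr) fun i hi => by
    have := ha i hi
    rw [key] at this
    ext x
    simpa using congrFun this (Sum.inr x)
  ext j x
  cases x with
  | inl x => exact congrFun (congrFun h1 j) x
  | inr x => exact congrFun (congrFun h2 j) x

theorem PairwiseControllable.reindexed {H : Fin 3 → Fin 3 → Matrix Y X ℂ}
    (h : PairwiseControllable H S) (e : Y' ≃ Y) (e' : X' ≃ X) (f : S' ≃ S) :
    PairwiseControllable (reindexed e e' H) S' := by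
  obtain ⟨Q, hQ⟩ := h
  refine ⟨fun j => (Q j).submatrix f e, fun g a ha => ?_⟩
  have h1 := hQ g (fun j => a j ∘ f.symm) fun i hi => by
    have := ha i hi
    simp only [CoopX.reindexed, Matrix.submatrix_mul_equiv, Matrix.submatrix_vecMul_equiv] at this
    ext x
    simpa using congrFun this (e'.symm x)
  ext j x
  simpa using congrFun (congrFun h1 j) (f x)

/-- Pairwise controllability is an open condition, and it implies neutralization. -/
theorem PairwiseControllable.neutralizes {I : Type*} [DecidableEq S]
    {H : (I → ℂ) → Fin 3 → Fin 3 → Matrix Y X ℂ} (hH : ∀ j i, PolyMat fun h => H h j i)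
    {h₀ : I → ℂ} (h : PairwiseControllable (H h₀) S) (σ : Equiv.Perm (Fin 3)) :
    ∃ f ∈ polyFun I, f h₀ ≠ 0 ∧ ∀ h, f h ≠ 0 → Neutralizes (H h) S σ := by
  classical
  obtain ⟨Q, hQ⟩ := h
  -- The map from the signals of the pair to all combined signals, with transmitter `g` switched
  -- off. Controllability says that its rows are independent, so it has a right inverse `B` at `h₀`.
  let A : (I → ℂ) → Fin 3 → Matrix (Fin 3 × S) (Fin 3 × X) ℂ := fun h g =>
    Matrix.of fun p q => if q.1 = g then 0 else (Q p.1 * H h p.1 q.1) p.2 q.2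
  have hA : ∀ g, PolyMat fun h => A h g := by
    intro g p q
    by_cases hq : q.1 = g
    · simpa [A, hq] using const_mem_polyFun (0 : ℂ)
    · simpa [A, hq] using ((PolyMat.const (Q p.1)).mul (hH p.1 q.1)) p.2 q.2
  have hinj : ∀ g, ∃ B : Matrix (Fin 3 × X) (Fin 3 × S) ℂ, A h₀ g * B = 1 := by
    intro g
    obtain ⟨L, hL⟩ := exists_left_inverse_matrix (A h₀ g)ᵀ (by
      intro v hv
      rw [Matrix.mulVec_transpose] at hv
      have := hQ g (fun j x => v (j, x)) (by
        intro i hi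
        ext x
        have := congrFun hv (i, x)
        simpa [A, hi, Matrix.vecMul, dotProduct, Fintype.sum_prod_type] using this)
      ext ⟨j, x⟩
      exact congrFun (congrFun this j) x)
    exact ⟨Lᵀ, by rw [← Matrix.transpose_inj]; simpa using hL⟩
  choose B hB using hinj
  refine ⟨fun h => ∏ k, (A h (σ k) * B (σ k)).det, ?_, ?_, ?_⟩
  · have := (polyFun I).prod_mem (t := Finset.univ) fun (k : Fin 3) _ =>
      ((hA (σ k)).mul (PolyMat.const (B (σ k)))).det
    convert this using 1
    ext h
    simp
  · simp [hB]
  · intro h hh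
    have hdet : ∀ k, (A h (σ k) * B (σ k)).det ≠ 0 := fun k =>
      (Finset.prod_ne_zero_iff.1 hh) k (Finset.mem_univ k)
    -- A right inverse of `A h (σ k)` up to the factor `det`. Its column `(k, y)` excites only
    -- stream `y` of receiver `k`, which makes it a neutralizing precoder.
    let C : Fin 3 → Matrix (Fin 3 × X) (Fin 3 × S) ℂ := fun k =>
      B (σ k) * (A h (σ k) * B (σ k)).adjugate
    have hC : ∀ k, A h (σ k) * C k = (A h (σ k) * B (σ k)).det • 1 := by
      intro k
      rw [← Matrix.mul_assoc, Matrix.mul_adjugate]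
    let V : Fin 3 → Fin 3 → Matrix X S ℂ := fun k i =>
      if i = σ k then 0 else Matrix.of fun x y => C k (i, x) (k, y)
    have hV : ∀ j k, Q j * ∑ i, H h j i * V k i =
        if j = k then (A h (σ k) * B (σ k)).det • 1 else 0 := by
      intro j k
      have : Q j * ∑ i, H h j i * V k i =
          Matrix.of fun x y => (A h (σ k) * C k) (j, x) (k, y) := by
        ext x y
        simp only [Matrix.mul_sum, Matrix.sum_apply, Matrix.of_apply]
        rw [Matrix.mul_apply, Fintype.sum_prod_type]
        refine Finset.sum_congr rfl fun i _ => ?_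
        rw [← Matrix.mul_assoc, Matrix.mul_apply]
        refine Finset.sum_congr rfl fun z _ => ?_
        by_cases hi : i = σ k <;> simp [A, V, hi]
      rw [this, hC]
      ext x y
      by_cases hjk : j = k <;> simp [hjk, Matrix.one_apply]
    refine ⟨V, Q, fun k => by simp [V], fun j k hkj => ?_, fun j => ?_⟩
    · rw [hV, if_neg (Ne.symm hkj)]
    · rw [hV, if_pos rfl, Matrix.isUnit_iff_isUnit_det]
      simp [hdet j]

end PairwiseControllable

/-- The coefficients of a channel. -/
def Channel.coeffs {M N : ℕ} (H : Channel M N) : Fin 3 × Fin 3 × Fin N × Fin M → ℂ :=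
  fun p => H p.1 p.2.1 p.2.2.1 p.2.2.2

theorem channelOf_coeffs {M N : ℕ} (H : Channel M N) : channelOf H.coeffs = H := rfl

/-- Some channel with `M` and `N` antennas is pairwise controllable with `s` streams in `n`
channel uses. -/
def ControllableDims (n M N s : ℕ) : Prop :=
  ∃ H : Channel M N, PairwiseControllable (extended n H) (Fin s)

namespace ControllableDims

variable {n n' M N s M' N' s' : ℕ}

theorem add (h : ControllableDims n M N s) (h' : ControllableDims n M' N' s') :
    ControllableDims n (M + M') (N + N') (s + s') := by
  obtain ⟨H, hH⟩ := h
  obtain ⟨H', hH'⟩ := h'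
  refine ⟨H.sum H', ?_⟩
  rw [extended_sum]
  exact (hH.blockSum hH').reindexed _ _ finSumFinEquiv.symm

theorem zero (n M N : ℕ) : ControllableDims n M N 0 :=
  ⟨0, 0, fun _ _ _ => by ext _ x; exact x.elim0⟩

theorem nsmul (h : ControllableDims n M N s) (a : ℕ) :
    ControllableDims n (a * M) (a * N) (a * s) := by
  induction a with
  | zero => simpa using zero n 0 0
  | succ a ih => simpa [add_mul] using ih.add h

theorem nsmul_extend (h : ControllableDims 1 M N s) (n : ℕ) : ControllableDims n M N (n * s) := by
  obtain ⟨H, hH⟩ := h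
  refine ⟨H, ?_⟩
  induction n with
  | zero => exact ⟨0, fun _ _ _ => by ext _ x; exact (Fin.cast (by simp) x : Fin 0).elim0⟩
  | succ n ih =>
    rw [extended_add]
    exact (ih.blockSum hH).reindexed _ _
      ((finCongr (by ring : (n + 1) * s = n * s + s)).trans finSumFinEquiv.symm)

theorem ae_neutralizingPhase (h : ControllableDims n M N s) (σ : Equiv.Perm (Fin 3))
    (μ : Measure ℂ) [IsProbabilityMeasure μ] [NullSingletonClass μ] :
    ∀ᵐ h ∂channelLaw M N μ, NeutralizingPhase (channelOf h) n s σ := by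
  obtain ⟨H, hH⟩ := h
  obtain ⟨f, hf, h0, hgood⟩ := PairwiseControllable.neutralizes
    (H := fun h => extended n (channelOf h)) (h₀ := H.coeffs)
    (fun j i => polyMat_extend n (polyMat_channel M N j i)) hH σ
  filter_upwards [ae_ne_zero_of_mem_polyFun μ hf h0] with h hh
  exact hgood h hh

/-- Every transmitter reaches two of the receivers, each through its own antenna, and every receiver
is reached by two transmitters. Any pair thus covers all three receivers. -/
theorem two_one : ControllableDims 1 2 1 1 := by
  refine ⟨![![!![1, 0], !![0, 0], !![1, 0]], ![!![0, 1], !![1, 0], !![0, 0]],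
    ![!![0, 0], !![0, 1], !![0, 1]]], fun _ => Matrix.of fun _ _ => 1, fun g a ha => ?_⟩
  have h0 := fun hg => congrFun (ha 0 hg)
  have h1 := fun hg => congrFun (ha 1 hg)
  have h2 := fun hg => congrFun (ha 2 hg)
  simp [Fin.sum_univ_succ, Fin.forall_fin_succ, Matrix.vecMul, dotProduct, Matrix.mul_apply,
    Fintype.sum_prod_type, extended, extend, Matrix.kroneckerMap_apply] at h0 h1 h2
  fin_cases g <;> simp at h0 h1 h2 <;> ext j x <;> fin_cases j <;> fin_cases x <;> simp [*]

/-- Transmitters `0` and `1` control complementary halves of the six receive coordinates. Each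
antenna of transmitter `2` hits one coordinate of either half, so it supplies whichever half the
other member of the pair lacks. -/
theorem three_two : ControllableDims 1 3 2 2 := by
  refine ⟨![![!![1, 0, 0; 0, 1, 0], !![0, 0, 0; 0, 0, 0], !![1, 0, 0; 0, 1, 0]],
    ![!![0, 0, 1; 0, 0, 0], !![0, 0, 0; 1, 0, 0], !![0, 0, 1; 1, 0, 0]],
    ![!![0, 0, 0; 0, 0, 0], !![0, 1, 0; 0, 0, 1], !![0, 1, 0; 0, 0, 1]]],
    fun _ => Matrix.of fun x y => if x = y.2 then 1 else 0, fun g a ha => ?_⟩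
  have h0 := fun hg => congrFun (ha 0 hg)
  have h1 := fun hg => congrFun (ha 1 hg)
  have h2 := fun hg => congrFun (ha 2 hg)
  simp [Fin.sum_univ_succ, Fin.forall_fin_succ, Matrix.vecMul, dotProduct, Matrix.mul_apply,
    Fintype.sum_prod_type, extended, extend, Matrix.kroneckerMap_apply] at h0 h1 h2
  fin_cases g <;> simp at h0 h1 h2 <;> ext j x <;> fin_cases j <;> fin_cases x <;>
    simp_all

/-- Receiver `j` does not hear transmitter `j`, and it ignores one of the three channel uses. In
each channel use just two receivers listen, and any two transmitters control any two receivers. -/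
theorem one_one : ControllableDims 3 1 1 2 := by
  refine ⟨fun j i => Matrix.of fun _ _ => if j = i then 0 else 1,
    ![Matrix.of fun x y => if y.1 = ![0, 1] x then 1 else 0,
      Matrix.of fun x y => if y.1 = ![1, 2] x then 1 else 0,
      Matrix.of fun x y => if y.1 = ![0, 2] x then 1 else 0], fun g a ha => ?_⟩
  have h0 := fun hg => congrFun (ha 0 hg)
  have h1 := fun hg => congrFun (ha 1 hg)
  have h2 := fun hg => congrFun (ha 2 hg)
  simp [Fin.sum_univ_succ, Fin.forall_fin_succ, Matrix.vecMul, dotProduct, Matrix.mul_apply,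
    Fintype.sum_prod_type, extended, extend, Matrix.kroneckerMap_apply, Matrix.one_apply]
    at h0 h1 h2
  fin_cases g <;> simp at h0 h1 h2 <;> ext j x <;> fin_cases j <;> fin_cases x <;>
    simp_all

/-- Up to `N / M = 2 / 3` all receive antennas can be controlled. -/
theorem of_le_two_thirds (h : 3 * N ≤ 2 * M) : ControllableDims 1 M N N := by
  by_cases h2 : 2 * N ≤ M
  · have := (two_one.nsmul N).add (zero 1 (M - N * 2) 0)
    convert this using 1 <;> omega
  -- The multiplicities solve `3 * a + 2 * b = M`, `2 * a + b = N`.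
  · have := (three_two.nsmul (2 * N - M)).add (two_one.nsmul (2 * M - 3 * N))
    convert this using 1 <;> omega

/-- From `N / M = 2 / 3` on, `2 M` streams in three channel uses can be controlled. -/
theorem of_two_thirds_le (h : 2 * M ≤ 3 * N) : ControllableDims 3 M N (2 * M) := by
  by_cases h2 : M ≤ N
  · have := (one_one.nsmul M).add (zero 3 0 (N - M))
    convert this using 1 <;> omega
  -- The multiplicities solve `3 * a + b = M`, `2 * a + b = N`.
  · have := ((three_two.nsmul_extend 3).nsmul (M - N)).add (one_one.nsmul (3 * N - 2 * M))
    convert this using 1 <;> omega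

end ControllableDims

/-! ### Neutralization by aligning interference -/

/-- A channel on which interference can be aligned by neutralization. The message of receiver `k` is
sent by the transmitters `k + 1` and `k + 2` with the precoding matrices `A k`, `B k` and `F k`. At
receiver `j`, the streams precoded by `A (j + 2)` neutralize those precoded by `B (j + 1)`, and there
are no other linear relations between the streams. -/
def Alignable {X Y : Type*} [Fintype X] [Fintype Y] [DecidableEq Y]
    (H : Fin 3 → Fin 3 → Matrix Y X ℂ) (ρ φ : Type*) [Fintype ρ] [Fintype φ] : Prop :=
  (∃ R : Fin 3 → Fin 3 → Matrix X Y ℂ, ∀ j, ∑ i, H j i * R j i = 1) ∧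
  ∃ (A B : Fin 3 → Fin 3 → Matrix X ρ ℂ) (F : Fin 3 → Fin 3 → Matrix X φ ℂ),
    (∀ k, A k k = 0 ∧ B k k = 0 ∧ F k k = 0) ∧
    (∀ j, ∑ i, H j i * (A (j + 2) i + B (j + 1) i) = 0) ∧
    ∀ (j : Fin 3) (a b : Fin 3 → ρ → ℂ) (c : Fin 3 → φ → ℂ), a (j + 2) = 0 →
      ∑ i, H j i *ᵥ ∑ k, (A k i *ᵥ a k + B k i *ᵥ b k + F k i *ᵥ c k) = 0 →
      a = 0 ∧ b = 0 ∧ c = 0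

section Alignable

variable {X Y X' Y' ρ φ ρ' φ' : Type*} [Fintype X] [Fintype Y] [Fintype X'] [Fintype Y']
  [DecidableEq Y] [DecidableEq Y'] [Fintype ρ] [Fintype φ] [Fintype ρ'] [Fintype φ']

theorem Alignable.blockSum {H : Fin 3 → Fin 3 → Matrix Y X ℂ}
    {H' : Fin 3 → Fin 3 → Matrix Y' X' ℂ} (h : Alignable H ρ φ) (h' : Alignable H' ρ' φ') :
    Alignable (blockSum H H') (ρ ⊕ ρ') (φ ⊕ φ') := by
  obtain ⟨⟨R, hR⟩, A, B, F, h0, hz, hk⟩ := h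
  obtain ⟨⟨R', hR'⟩, A', B', F', h0', hz', hk'⟩ := h'
  refine ⟨⟨fun j i => Matrix.fromBlocks (R j i) 0 0 (R' j i), fun j => ?_⟩,
    fun k i => Matrix.fromBlocks (A k i) 0 0 (A' k i),
    fun k i => Matrix.fromBlocks (B k i) 0 0 (B' k i),
    fun k i => Matrix.fromBlocks (F k i) 0 0 (F' k i), fun k => ?_, fun j => ?_,
    fun j a b c ha hs => ?_⟩
  · have h1 := hR j
    have h2 := hR' j
    simp only [Fin.sum_univ_three] at h1 h2 ⊢
    simp [CoopX.blockSum, Matrix.fromBlocks_multiply, Matrix.fromBlocks_add, h1, h2]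
  · simp [h0, h0']
  · have h1 := hz j
    have h2 := hz' j
    simp only [Fin.sum_univ_three] at h1 h2 ⊢
    simp [CoopX.blockSum, Matrix.fromBlocks_multiply, Matrix.fromBlocks_add, h1, h2]
  · have e1 := hk j (fun k => a k ∘ Sum.inl) (fun k => b k ∘ Sum.inl) (fun k => c k ∘ Sum.inl)
      (by ext x; simp [ha]) (by
        ext y
        have := congrFun hs (Sum.inl y)
        simpa [Fin.sum_univ_three, CoopX.blockSum, Matrix.fromBlocks_mulVec,
          Function.comp_def, Matrix.mulVec_add] using this)
    have e2 := hk' j (fun k => a k ∘ Sum.inr) (fun k => b k ∘ Sum.inr) (fun k => c k ∘ Sum.inr)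
      (by ext x; simp [ha]) (by
        ext y
        have := congrFun hs (Sum.inr y)
        simpa [Fin.sum_univ_three, CoopX.blockSum, Matrix.fromBlocks_mulVec,
          Function.comp_def, Matrix.mulVec_add] using this)
    refine ⟨?_, ?_, ?_⟩
    · ext k (x | x)
      · exact congrFun (congrFun e1.1 k) x
      · exact congrFun (congrFun e2.1 k) x
    · ext k (x | x)
      · exact congrFun (congrFun e1.2.1 k) x
      · exact congrFun (congrFun e2.2.1 k) x
    · ext k (x | x)
      · exact congrFun (congrFun e1.2.2 k) x
      · exact congrFun (congrFun e2.2.2 k) x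

theorem Alignable.reindexed {H : Fin 3 → Fin 3 → Matrix Y X ℂ} (h : Alignable H ρ φ) (e : Y' ≃ Y)
    (e' : X' ≃ X) (f : ρ' ≃ ρ) (g : φ' ≃ φ) : Alignable (reindexed e e' H) ρ' φ' := by
  obtain ⟨⟨R, hR⟩, A, B, F, h0, hz, hk⟩ := h
  refine ⟨⟨fun j i => (R j i).submatrix e' e, fun j => ?_⟩,
    fun k i => (A k i).submatrix e' f, fun k i => (B k i).submatrix e' f,
    fun k i => (F k i).submatrix e' g, fun k => ?_, fun j => ?_, fun j a b c ha hs => ?_⟩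
  · have h1 := hR j
    simp only [CoopX.reindexed, Matrix.submatrix_mul_equiv]
    ext x y
    have := congrFun (congrFun h1 (e x)) (e y)
    simpa [Matrix.sum_apply, Matrix.one_apply] using this
  · simp [h0]
  · have h1 := hz j
    ext x y
    have := congrFun (congrFun h1 (e x)) (f y)
    change (∑ i, (H j i).submatrix e e' * (A (j + 2) i + B (j + 1) i).submatrix e' f) x y = 0
    simp only [Matrix.submatrix_mul_equiv]
    simpa [Matrix.sum_apply] using this
  · have e1 := hk j (fun k => a k ∘ f.symm) (fun k => b k ∘ f.symm) (fun k => c k ∘ g.symm)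
      (by ext x; simp [ha]) (by
        ext y
        have := congrFun hs (e.symm y)
        simp only [CoopX.reindexed, Matrix.submatrix_mulVec_equiv] at this
        simpa [Fin.sum_univ_three, Function.comp_def, Matrix.mulVec_add, Pi.add_def] using this)
    refine ⟨?_, ?_, ?_⟩
    · ext k x
      simpa using congrFun (congrFun e1.1 k) (f x)
    · ext k x
      simpa using congrFun (congrFun e1.2.1 k) (f x)
    · ext k x
      simpa using congrFun (congrFun e1.2.2 k) (g x)

theorem sum_cyclic {α : Type*} [AddCommMonoid α] (f : Fin 3 → α) (j : Fin 3) :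
    ∑ k, f k = f j + f (j + 1) + f (j + 2) := by
  fin_cases j <;> simp [Fin.sum_univ_three] <;> abel

set_option maxHeartbeats 1000000 in
/-- Alignability is an open condition, and it implies neutralization. -/
theorem Alignable.neutralizes {I : Type*} [DecidableEq ρ] [DecidableEq φ]
    {H : (I → ℂ) → Fin 3 → Fin 3 → Matrix Y X ℂ} (hH : ∀ j i, PolyMat fun h => H h j i)
    {h₀ : I → ℂ} (hal : Alignable (H h₀) ρ φ) :
    ∃ f ∈ polyFun I, f h₀ ≠ 0 ∧ ∀ h, f h ≠ 0 → Neutralizes (H h) (ρ ⊕ ρ ⊕ φ) 1 := by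
  obtain ⟨⟨R, hR⟩, A, B, F, h0, hz, hk⟩ := hal
  let G : (I → ℂ) → Fin 3 → Matrix Y Y ℂ := fun h j => ∑ i, H h j i * R j i
  let E : (I → ℂ) → Fin 3 → Matrix Y ρ ℂ := fun h j => ∑ i, H h j i * (A (j + 2) i + B (j + 1) i)
  -- The neutralizing signals at `h₀`, corrected through `R` so that receiver `j` hears nothing for
  -- every `h`. The adjugate replaces the inverse of `G` to keep the entries polynomial.
  let Z : (I → ℂ) → Fin 3 → Fin 3 → Matrix X ρ ℂ := fun h j i =>
    (G h j).det • (A (j + 2) i + B (j + 1) i) - R j i * ((G h j).adjugate * E h j)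
  have hG : ∀ j, PolyMat fun h => G h j := fun j =>
    PolyMat.sum fun i => (hH j i).mul (PolyMat.const _)
  have hE : ∀ j, PolyMat fun h => E h j := fun j =>
    PolyMat.sum fun i => (hH j i).mul (PolyMat.const _)
  have hZ : ∀ j i, PolyMat fun h => Z h j i := fun j i =>
    (PolyMat.smul (hG j).det (PolyMat.const _)).sub
      ((PolyMat.const _).mul ((hG j).adjugate.mul (hE j)))
  have hZ0 : ∀ h j, ∑ i, H h j i * Z h j i = 0 := by
    intro h j
    have : ∑ i, H h j i * Z h j i = (G h j).det • E h j - G h j * ((G h j).adjugate * E h j) := by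
      simp only [Z, Matrix.mul_sub, Finset.sum_sub_distrib, ← Matrix.mul_assoc]
      simp only [G, E, Matrix.sum_mul, Finset.smul_sum, Matrix.mul_smul, Matrix.mul_assoc]
    rw [this, ← Matrix.mul_assoc, Matrix.mul_adjugate]
    simp
  have hZ1 : ∀ j i, Z h₀ j i = A (j + 2) i + B (j + 1) i := by
    intro j i
    have h1 : G h₀ j = 1 := hR j
    have h2 : E h₀ j = 0 := hz j
    simp [Z, h1, h2]
  -- `Z h j` has to be split into precoders for messages `j + 2` and `j + 1`. Transmitter `j + 1`
  -- knows only the former and `j + 2` only the latter, which forces their parts. Transmitter `j`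
  -- knows both: it keeps `A (j + 2) j`, and `B'` takes the remainder.
  let A' : (I → ℂ) → Fin 3 → Fin 3 → Matrix X ρ ℂ := fun h k i =>
    if i = k + 1 then A k i else if i = k + 2 then Z h (k + 1) i else 0
  let B' : (I → ℂ) → Fin 3 → Fin 3 → Matrix X ρ ℂ := fun h k i =>
    if i = k + 1 then Z h (k + 2) i else if i = k + 2 then Z h (k + 2) i - A (k + 1) i else 0
  have hA' : ∀ k i, PolyMat fun h => A' h k i := by
    intro k i
    simp only [A']
    split_ifs
    exacts [PolyMat.const _, hZ _ _, PolyMat.const _]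
  have hB' : ∀ k i, PolyMat fun h => B' h k i := by
    intro k i
    simp only [B']
    split_ifs
    exacts [hZ _ _, (hZ _ _).sub (PolyMat.const _), PolyMat.const _]
  have hA0 : A' h₀ = A := by
    funext k i
    simp only [A', hZ1]
    fin_cases k <;> fin_cases i <;> simp [h0]
  have hB0 : B' h₀ = B := by
    funext k i
    simp only [B', hZ1]
    fin_cases k <;> fin_cases i <;> simp [h0]
  have hAd : ∀ h k, A' h k k = 0 := by
    intro h k
    fin_cases k <;> simp [A']
  have hBd : ∀ h k, B' h k k = 0 := by
    intro h k
    fin_cases k <;> simp [B']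
  have hAB : ∀ h j i, A' h (j + 2) i + B' h (j + 1) i = Z h j i := by
    intro h j i
    fin_cases j <;> fin_cases i <;> simp [A', B']
  let V : (I → ℂ) → Fin 3 → Fin 3 → Matrix X (ρ ⊕ ρ ⊕ φ) ℂ := fun h k i =>
    Matrix.fromCols (A' h k i) (Matrix.fromCols (B' h k i) (F k i))
  have hV : ∀ k i, PolyMat fun h => V h k i := by
    intro k i x s
    rcases s with s | s | s
    exacts [hA' k i x s, hB' k i x s, PolyMat.const (F k i) x s]
  -- Appending the coefficients of the `A (j + 2)` streams to the received signal turns "no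
  -- relations other than the neutralizing ones" into injectivity, which a determinant detects.
  let T : (I → ℂ) → Fin 3 → Matrix (Y ⊕ ρ) (Fin 3 × (ρ ⊕ ρ ⊕ φ)) ℂ := fun h j =>
    Matrix.of fun y p => Sum.elim (fun y => (∑ i, H h j i * V h p.1 i) y p.2)
      (fun r => if p = (j + 2, Sum.inl r) then 1 else 0) y
  have hT : ∀ j, PolyMat fun h => T h j := by
    intro j y p
    rcases y with y | y
    · exact PolyMat.sum (s := Finset.univ) (fun i => (hH j i).mul (hV p.1 i)) y p.2
    · exact const_mem_polyFun _
  have hTs : ∀ h j v y, (T h j *ᵥ v) (Sum.inl y) =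
      (∑ k, (∑ i, H h j i * V h k i) *ᵥ fun s => v (k, s)) y := by
    intro h j v y
    rw [Finset.sum_apply, Matrix.mulVec, dotProduct, Fintype.sum_prod_type]
    rfl
  have hTl : ∀ h j v y, (T h j *ᵥ v) (Sum.inl y) =
      (∑ i, H h j i *ᵥ ∑ k, V h k i *ᵥ fun s => v (k, s)) y := by
    intro h j v y
    rw [hTs]
    simp only [Matrix.mulVec_sum, Matrix.sum_mulVec, Matrix.mulVec_mulVec]
    rw [Finset.sum_comm]
  have hTr : ∀ h j v r, (T h j *ᵥ v) (Sum.inr r) = v (j + 2, Sum.inl r) := by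
    intro h j v r
    simp [T, Matrix.mulVec, dotProduct]
  have hL : ∀ j, ∃ L : Matrix (Fin 3 × (ρ ⊕ ρ ⊕ φ)) (Y ⊕ ρ) ℂ, L * T h₀ j = 1 := by
    intro j
    refine exists_left_inverse_matrix _ fun v hv => ?_
    have := hk j (fun k r => v (k, Sum.inl r)) (fun k r => v (k, Sum.inr (Sum.inl r)))
      (fun k r => v (k, Sum.inr (Sum.inr r))) (by
        ext r
        have := congrFun hv (Sum.inr r)
        rwa [hTr] at this) (by
        ext y
        have := congrFun hv (Sum.inl y)
        rw [hTl] at this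
        simpa [V, hA0, hB0, Matrix.fromCols_mulVec, Function.comp_def, add_assoc] using this)
    ext ⟨k, s⟩
    rcases s with s | s | s
    exacts [congrFun (congrFun this.1 k) s, congrFun (congrFun this.2.1 k) s,
      congrFun (congrFun this.2.2 k) s]
  choose L hL using hL
  refine ⟨fun h => ∏ j, (L j * T h j).det, ?_, ?_, ?_⟩
  · have := (polyFun I).prod_mem (t := Finset.univ) fun (j : Fin 3) _ =>
      ((PolyMat.const (L j)).mul (hT j)).det
    convert this using 1
    ext h
    simp
  · simp [hL]
  intro h hh
  have hinj : ∀ j v, T h j *ᵥ v = 0 → v = 0 := by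
    intro j v hv
    have hdet : (L j * T h j).det ≠ 0 := (Finset.prod_ne_zero_iff.1 hh) j (Finset.mem_univ j)
    refine Matrix.eq_zero_of_mulVec_eq_zero hdet ?_
    rw [← Matrix.mulVec_mulVec, hv, Matrix.mulVec_zero]
  have hQ : ∀ j, ∃ Q : Matrix (ρ ⊕ ρ ⊕ φ) Y ℂ, Q * (∑ i, H h j i * V h j i) = 1 ∧
      Q * (Matrix.of fun y (p : Fin 3 × (ρ ⊕ ρ ⊕ φ)) =>
        if p.1 = j then 0 else (∑ i, H h j i * V h p.1 i) y p.2) = 0 := by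
    intro j
    refine exists_combining_matrix _ _ fun c d hcd => ?_
    -- Let `v` be any relation at receiver `j`, and `u` the neutralizing relation with the same `A
    -- (j + 2)` coefficients. Injectivity of `T h j` gives `v = u`, and `u` does not involve the
    -- desired streams.
    let v : Fin 3 × (ρ ⊕ ρ ⊕ φ) → ℂ := fun p => if p.1 = j then c p.2 else d p
    let e : ρ → ℂ := fun r => v (j + 2, Sum.inl r)
    let u : Fin 3 × (ρ ⊕ ρ ⊕ φ) → ℂ := fun p =>
      if p.1 = j + 2 then Sum.elim e 0 p.2
      else if p.1 = j + 1 then Sum.elim 0 (Sum.elim e 0) p.2 else 0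
    have hu : ∀ i, ∑ k, V h k i *ᵥ (fun s => u (k, s)) = Z h j i *ᵥ e := by
      intro i
      rw [← hAB, Matrix.add_mulVec]
      have h1 : (fun s => u (j, s)) = 0 := by
        ext s
        simp [u]
      have h2 : (fun s => u (j + 1, s)) = (Sum.elim 0 (Sum.elim e 0) : ρ ⊕ ρ ⊕ φ → ℂ) := by
        ext s
        simp [u]
      have h3 : (fun s => u (j + 2, s)) = Sum.elim e 0 := by
        ext s
        simp [u]
      rw [sum_cyclic _ j, h1, h2, h3]
      simp only [V, Matrix.fromCols_mulVec, Sum.elim_comp_inl, Sum.elim_comp_inr,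
        Matrix.mulVec_zero, zero_add, add_zero]
      exact add_comm _ _
    have hTu : ∀ y, (T h j *ᵥ u) (Sum.inl y) = 0 := by
      intro y
      rw [hTl]
      rw [Finset.sum_congr rfl fun i _ => by rw [hu i, Matrix.mulVec_mulVec],
        ← Matrix.sum_mulVec, hZ0, Matrix.zero_mulVec, Pi.zero_apply]
    have hTv : ∀ y, (T h j *ᵥ v) (Sum.inl y) = 0 := by
      intro y
      have := congrFun hcd y
      rw [hTs]
      simp only [Pi.add_apply, Pi.zero_apply, Matrix.mulVec, dotProduct, Matrix.of_apply,
        Fintype.sum_prod_type] at this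
      rw [sum_cyclic (fun k => ∑ s, _ * d (k, s)) j] at this
      rw [← this, Finset.sum_apply, sum_cyclic _ j]
      simp [v, Matrix.mulVec, dotProduct, add_assoc]
    have hvu : v - u = 0 := by
      refine hinj j _ ?_
      rw [Matrix.mulVec_sub]
      ext y
      rcases y with y | r
      · simp [hTu, hTv]
      · simp [hTr, u, e]
    ext s
    have := congrFun hvu (j, s)
    simpa [v, u] using this
  choose Q hQ1 hQ0 using hQ
  refine ⟨V h, Q, fun k => ?_, fun j k hjk => ?_, fun j => ?_⟩
  · ext x s
    rcases s with s | s | s <;> simp [V, hAd, hBd, h0]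
  · ext x s
    have := congrFun (congrFun (hQ0 j) x) (k, s)
    simpa [Matrix.mul_apply, hjk] using this
  · rw [hQ1]
    exact isUnit_one

end Alignable

theorem extend_mulVec {M N : ℕ} (n : ℕ) (A : Matrix (Fin N) (Fin M) ℂ) (x : Fin n × Fin M → ℂ)
    (t : Fin n) (y : Fin N) : (extend n A *ᵥ x) (t, y) = (A *ᵥ fun m => x (t, m)) y := by
  simp [extend, Matrix.mulVec, dotProduct, Fintype.sum_prod_type, Matrix.one_apply]

theorem Neutralizes.reindex {X Y S S' : Type*} [Fintype X] [Fintype Y] [Fintype S] [Fintype S']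
    [DecidableEq S] [DecidableEq S'] {H : Fin 3 → Fin 3 → Matrix Y X ℂ} {σ : Equiv.Perm (Fin 3)}
    (h : Neutralizes H S σ) (e : S' ≃ S) : Neutralizes H S' σ := by
  obtain ⟨V, Q, h1, h2, h3⟩ := h
  have key : ∀ j k, (Q j).submatrix e id * ∑ i, H j i * (V k i).submatrix id e =
      (Q j * ∑ i, H j i * V k i).submatrix e e := by
    intro j k
    ext x y
    simp [Matrix.mul_apply, Matrix.sum_apply]
  refine ⟨fun k i => (V k i).submatrix id e, fun j => (Q j).submatrix e id, fun k => by simp [h1],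
    fun j k hjk => ?_, fun j => ?_⟩
  · rw [key, h2 j k hjk]
    rfl
  · rw [key, Matrix.isUnit_submatrix_equiv]
    exact h3 j

/-- Renumbering the receivers. -/
theorem Neutralizes.permute {X Y S : Type*} [Fintype X] [Fintype Y] [Fintype S]
    [DecidableEq S] {H : Fin 3 → Fin 3 → Matrix Y X ℂ} {σ : Equiv.Perm (Fin 3)}
    (h : Neutralizes (fun j => H (σ.symm j)) S 1) : Neutralizes H S σ := by
  obtain ⟨V, Q, h1, h2, h3⟩ := h
  refine ⟨fun k => V (σ k), fun j => Q (σ j), fun k => h1 (σ k), fun j k hjk => ?_, fun j => ?_⟩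
  · simpa using h2 (σ j) (σ k) (by simpa using hjk)
  · simpa using h3 (σ j)

/-- Some channel with `M` and `N` antennas is alignable in `n` channel uses, with `r` neutralizing
pairs of streams at each receiver and `f` free streams per message. -/
def AlignableDims (n M N r f : ℕ) : Prop :=
  ∃ H : Channel M N, Alignable (extended n H) (Fin r) (Fin f)

namespace AlignableDims

variable {n M N r f M' N' r' f' : ℕ}

theorem add (h : AlignableDims n M N r f) (h' : AlignableDims n M' N' r' f') :
    AlignableDims n (M + M') (N + N') (r + r') (f + f') := by
  obtain ⟨H, hH⟩ := h
  obtain ⟨H', hH'⟩ := h'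
  refine ⟨H.sum H', ?_⟩
  rw [extended_sum]
  exact (hH.blockSum hH').reindexed _ _ finSumFinEquiv.symm finSumFinEquiv.symm

theorem of_isEmpty (Y X : Type*) [Fintype X] [Fintype Y] [DecidableEq Y] [IsEmpty Y]
    (H : Fin 3 → Fin 3 → Matrix Y X ℂ) : Alignable H (Fin 0) (Fin 0) :=
  ⟨⟨0, fun _ => Subsingleton.elim _ _⟩, 0, 0, 0, fun _ => ⟨rfl, rfl, rfl⟩,
    fun _ => Subsingleton.elim _ _, fun _ _ _ _ _ _ =>
      ⟨Subsingleton.elim _ _, Subsingleton.elim _ _, Subsingleton.elim _ _⟩⟩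

theorem zero (n M : ℕ) : AlignableDims n M 0 0 0 :=
  ⟨0, of_isEmpty _ _ _⟩

theorem nsmul (h : AlignableDims n M N r f) (a : ℕ) :
    AlignableDims n (a * M) (a * N) (a * r) (a * f) := by
  induction a with
  | zero => simpa using zero n 0
  | succ a ih => simpa [add_mul] using ih.add h

theorem nsmul_extend (h : AlignableDims 1 M N r f) (n : ℕ) :
    AlignableDims n M N (n * r) (n * f) := by
  obtain ⟨H, hH⟩ := h
  refine ⟨H, ?_⟩
  induction n with
  | zero =>
    exact (of_isEmpty _ _ (extended 0 H)).reindexed (Equiv.refl _) (Equiv.refl _)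
      (finCongr (by simp)) (finCongr (by simp))
  | succ n ih =>
    rw [extended_add]
    exact (ih.blockSum hH).reindexed _ _
      ((finCongr (by ring : (n + 1) * r = n * r + r)).trans finSumFinEquiv.symm)
      ((finCongr (by ring : (n + 1) * f = n * f + f)).trans finSumFinEquiv.symm)

/-- `Alignable` is tied to the assignment in which transmitter `k` is idle for receiver `k`;
renumbering the receivers by `σ` reduces every other assignment to it. -/
theorem ae_neutralizingPhase (h : AlignableDims n M N r f) (σ : Equiv.Perm (Fin 3))
    (μ : Measure ℂ) [IsProbabilityMeasure μ] [NullSingletonClass μ] :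
    ∀ᵐ h ∂channelLaw M N μ, NeutralizingPhase (channelOf h) n (r + (r + f)) σ := by
  obtain ⟨H, hH⟩ := h
  obtain ⟨p, hp, h0, hgood⟩ := Alignable.neutralizes
    (H := fun h j => extended n (channelOf h) (σ.symm j))
    (h₀ := Channel.coeffs fun j => H (σ j))
    (fun j i => polyMat_extend n (polyMat_channel M N _ i)) (by
      have : (fun j => extended n (channelOf (Channel.coeffs fun j => H (σ j))) (σ.symm j)) =
          extended n H := by
        funext j i
        simp [extended, channelOf_coeffs]
      rw [this]
      exact hH)
  filter_upwards [ae_ne_zero_of_mem_polyFun μ hp h0] with h hh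
  exact (hgood h hh).permute.reindex
    (finSumFinEquiv.symm.trans ((Equiv.refl _).sumCongr finSumFinEquiv.symm))

theorem one_three : AlignableDims 1 1 3 0 1 := by
  refine ⟨fun _ i => Matrix.of fun a _ => if a = i then 1 else 0,
    ⟨fun _ i => Matrix.of fun _ a => if a.2 = i then 1 else 0, fun j => ?_⟩, 0, 0,
    fun k i => Matrix.of fun _ _ => if i = k + 1 then 1 else 0, fun k => ⟨rfl, rfl, ?_⟩,
    fun j => Subsingleton.elim _ _, fun j a b c ha h =>
      ⟨Subsingleton.elim _ _, Subsingleton.elim _ _, ?_⟩⟩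
  · ext ⟨t, x⟩ ⟨t', y⟩
    obtain rfl := Subsingleton.elim t 0
    obtain rfl := Subsingleton.elim t' 0
    fin_cases x <;> fin_cases y <;>
    simp [Fin.sum_univ_three, Matrix.mul_apply, Fintype.sum_prod_type, extended, extend]
  · ext
    simp
  · ext k x
    have := congrFun h (0, k + 1)
    fin_cases k <;> fin_cases x <;>
    simpa [Fin.sum_univ_three, Matrix.mulVec, dotProduct, Fintype.sum_prod_type, extended, extend]
      using this

/-- Transmitter `j` sends one symbol of message `j + 2` and one of message `j + 1` on its two
antennas. Receiver `j` sees only their difference, and the four symbols of the other transmitters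
separately: six streams in five dimensions. -/
theorem two_five : AlignableDims 1 2 5 1 0 := by
  refine ⟨fun j i => if i = j then !![1, -1; 0, 0; 0, 0; 0, 0; 0, 0]
      else if i = j + 1 then !![0, 0; 1, 0; 0, 1; 0, 0; 0, 0]
      else !![0, 0; 0, 0; 0, 0; 1, 0; 0, 1],
    ⟨fun j i => Matrix.of fun x y => (if i = j then !![1, 0, 0, 0, 0; 0, 0, 0, 0, 0]
      else if i = j + 1 then !![0, 1, 0, 0, 0; 0, 0, 1, 0, 0]
      else !![0, 0, 0, 1, 0; 0, 0, 0, 0, 1]) x.2 y.2, fun j => ?_⟩,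
    fun k i => Matrix.of fun x _ => if i = k + 1 ∧ x.2 = 0 then 1 else 0,
    fun k i => Matrix.of fun x _ => if i = k + 2 ∧ x.2 = 1 then 1 else 0,
    0, fun k => ⟨?_, ?_, rfl⟩, fun j => ?_, fun j a b c ha h => ?_⟩
  · rw [sum_cyclic _ j]
    ext ⟨t, x⟩ ⟨t', y⟩
    obtain rfl := Subsingleton.elim t 0
    obtain rfl := Subsingleton.elim t' 0
    fin_cases x <;> fin_cases y <;>
    simp [Matrix.mul_apply, Fintype.sum_prod_type, extended, extend, Matrix.one_apply,
      Fin.sum_univ_succ]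
  · ext
    simp
  · ext
    simp
  · rw [sum_cyclic _ j]
    ext ⟨t, x⟩ y
    fin_cases j <;> fin_cases x <;>
    simp [Matrix.mul_apply, Fintype.sum_prod_type, extended, extend, Fin.sum_univ_succ]
  · rw [Finset.sum_congr rfl fun i _ => congrArg _ (?_ : _ = fun x : Fin 1 × Fin 2 =>
      if x.2 = 0 then a (i + 2) 0 else b (i + 1) 0), sum_cyclic _ j] at h
    · have h1 : ∀ y, _ := fun y => congrFun h (0, y)
      simp [Fin.forall_fin_succ, Matrix.mulVec, dotProduct, Fintype.sum_prod_type, extended, extend,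
        Fin.sum_univ_two] at h1
      have h2 := congrFun ha 0
      clear h ha
      refine ⟨?_, ?_, Subsingleton.elim _ _⟩ <;> ext k x <;> obtain rfl := Subsingleton.elim x 0 <;>
      fin_cases j <;> fin_cases k <;> simp_all
    · ext ⟨t, x⟩
      rw [sum_cyclic _ i]
      clear h
      fin_cases x <;> simp [Matrix.mulVec, dotProduct] <;> fin_cases i <;> simp

/-- Receiver `j` observes `x j - x (j + 1)` and `x (j + 2)`, so it is blind to a signal sent
identically by transmitters `j` and `j + 1`. The columns of `t j` serve as such signals: for message
`j + 2` transmitter `j` sends `t j - p j` and transmitter `j + 1` sends `t j`; for message `j + 1`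
transmitter `j` adds the missing `p j`. -/
theorem one_two : AlignableDims 5 1 2 2 0 := by
  -- The cancellation holds for any `t` and `p`. These particular time patterns exclude further
  -- relations, a finite linear system solved in `key`.
  let t : Fin 3 → Matrix (Fin 5) (Fin 2) ℂ := ![!![1, 0; 0, 0; 1, 0; 0, 1; 0, 0],
    !![0, 0; 1, 0; 0, 1; 0, 0; 0, 0], !![0, 0; 0, 1; 0, 0; 0, 1; 1, 0]]
  let p : Fin 3 → Matrix (Fin 5) (Fin 2) ℂ := ![!![1, 0; 0, 0; 0, 1; 0, 0; 0, 0],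
    !![0, 0; 0, 1; 0, 0; 0, 0; 1, 0], !![1, 0; 0, 0; 0, 0; 0, 1; 1, 0]]
  refine ⟨fun j i => if i = j then !![1; 0] else if i = j + 1 then !![-1; 0] else !![0; 1],
    ⟨fun j i => extend 5 (if i = j then !![1, 0] else if i = j + 1 then !![0, 0] else !![0, 1]),
      fun j => ?_⟩,
    fun k i => Matrix.of fun x r => if i = k + 1 then t i x.1 r - p i x.1 r
      else if i = k + 2 then t (k + 1) x.1 r else 0,
    fun k i => Matrix.of fun x r => if i = k + 2 then p i x.1 r else 0,
    0, fun k => ⟨?_, ?_, rfl⟩, fun j => ?_, fun j a b c ha h => ?_⟩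
  · simp only [extended, extend, ← Matrix.mul_kronecker_mul]
    rw [sum_cyclic _ j, ← Matrix.kronecker_add, ← Matrix.kronecker_add,
      ← Matrix.one_kronecker_one, mul_one]
    congr 1
    ext x y
    fin_cases x <;> fin_cases y <;> simp
  · ext
    simp
  · ext
    simp
  · rw [sum_cyclic _ j]
    ext ⟨τ, x⟩ y
    clear_value t p
    fin_cases j <;> fin_cases x <;>
    simp [Matrix.mul_apply, Fintype.sum_prod_type, extended, extend, Matrix.one_apply]
  · rw [Finset.sum_congr rfl fun i _ => congrArg _ (?_ : _ = fun x : Fin 5 × Fin 1 =>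
      (t i *ᵥ a (i + 2) - p i *ᵥ a (i + 2) + t (i + 2) *ᵥ a (i + 1) + p i *ᵥ b (i + 1)) x.1),
      sum_cyclic _ j] at h
    · have h1 := fun τ => congrFun h (τ, 0)
      have h2 := fun τ => congrFun h (τ, 1)
      simp [extended, extend_mulVec] at h1 h2
      have h3 := congrFun ha 0
      have h4 := congrFun ha 1
      clear h ha
      have key : (∀ k r, a k r = 0) ∧ ∀ k r, b k r = 0 := by
        simp only [Fin.forall_fin_succ, Matrix.mulVec, dotProduct, t, p, Fin.sum_univ_two] at h1 h2 ⊢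
        fin_cases j <;> simp at h1 h2 h3 h4 ⊢ <;> grind
      exact ⟨by ext; exact key.1 _ _, by ext; exact key.2 _ _, Subsingleton.elim _ _⟩
    · ext ⟨τ, x⟩
      clear h
      clear_value t p
      rw [sum_cyclic _ i]
      fin_cases i <;> simp [Matrix.mulVec, dotProduct] <;> ring

/-- For `N / M` between `5 / 3` and `5 / 2`, five channel uses can carry `2 N` streams. -/
theorem of_five_thirds_le (h : 5 * M ≤ 3 * N) (h' : 2 * N ≤ 5 * M) :
    AlignableDims 5 M N N 0 := by
  by_cases h2 : 2 * M ≤ N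
  · have := (one_two.nsmul (5 * M - 2 * N)).add ((two_five.nsmul_extend 5).nsmul (N - 2 * M))
    convert this using 1 <;> omega
  -- Below `N = 2 * M` the second generator is the `2 × 5` channel with a silent transmit antenna
  -- added, of ratio exactly `5 / 3`.
  · have := (one_two.nsmul (3 * N - 5 * M)).add
      (((two_five.nsmul_extend 5).add (zero 5 1)).nsmul (2 * M - N))
    convert this using 1 <;> omega

/-- For `N / M` between `5 / 2` and `3`, one channel use can carry `M` streams. -/
theorem of_five_halves_le (h : 5 * M ≤ 2 * N) (h' : N ≤ 3 * M) :
    AlignableDims 1 M N (3 * M - N) (2 * N - 5 * M) := by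
  have := (two_five.nsmul (3 * M - N)).add (one_three.nsmul (2 * N - 5 * M))
  convert this using 1 <;> omega

end AlignableDims

/-! ### Zero forcing, and assembly of all antenna ratios -/

/-- With at least as many receive antennas as there are transmit antennas in total, the receivers
can remove all the interference. -/
theorem ae_neutralizingPhase_of_three_mul_le {M N : ℕ} (hMN : 3 * M ≤ N) (σ : Equiv.Perm (Fin 3))
    (μ : Measure ℂ) [IsProbabilityMeasure μ] [NullSingletonClass μ] :
    ∀ᵐ h ∂channelLaw M N μ, NeutralizingPhase (channelOf h) 1 M σ := by
  let e : Fin 3 × Fin M → Fin N := fun p => Fin.castLE hMN (finProdFinEquiv p)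
  have he : Function.Injective e := (Fin.castLE_injective hMN).comp finProdFinEquiv.injective
  let L : Matrix (Fin 3 × Fin M) (Fin N) ℂ := Matrix.of fun p a => if a = e p then 1 else 0
  let T : (Fin 3 × Fin 3 × Fin N × Fin M → ℂ) → Fin 3 → Matrix (Fin N) (Fin 3 × Fin M) ℂ :=
    fun h j => Matrix.of fun a p => channelOf h j p.1 a p.2
  have hT : ∀ j, PolyMat fun h => T h j := fun j a p => polyMat_channel M N j p.1 a p.2
  let H₀ : Channel M N := fun _ i => Matrix.of fun a m => if a = e (i, m) then 1 else 0
  have hp : (fun h => ∏ j, (L * T h j).det) ∈ polyFun _ := by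
    have := (polyFun _).prod_mem (t := Finset.univ) fun (j : Fin 3) _ =>
      ((PolyMat.const L).mul (hT j)).det
    convert this using 1
    ext h
    simp
  have h0 : ∀ j, L * T H₀.coeffs j = 1 := by
    intro j
    ext p q
    simp [L, T, channelOf_coeffs, H₀, Matrix.mul_apply, Matrix.one_apply, he.eq_iff, eq_comm]
  filter_upwards [ae_ne_zero_of_mem_polyFun μ hp (h₀ := H₀.coeffs) (by simp [h0])] with h hh
  let W : Fin 3 → Matrix (Fin 3 × Fin M) (Fin N) ℂ := fun j => (L * T h j).adjugate * L
  have hW : ∀ j, W j * T h j = (L * T h j).det • 1 := by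
    intro j
    rw [Matrix.mul_assoc, Matrix.adjugate_mul]
  -- Only one member of each pair transmits. As `σ` is a permutation, the three active transmitters
  -- are distinct.
  let V : Fin 3 → Fin 3 → Matrix (Fin 1 × Fin M) (Fin M) ℂ := fun k i =>
    Matrix.of fun x y => if i = σ k + 1 ∧ x.2 = y then 1 else 0
  let Q : Fin 3 → Matrix (Fin M) (Fin 1 × Fin N) ℂ := fun j =>
    Matrix.of fun x y => W j (σ j + 1, x) y.2
  have key : ∀ j k, Q j * ∑ i, extend 1 (channelOf h j i) * V k i =
      if j = k then (L * T h j).det • 1 else 0 := by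
    intro j k
    have : Q j * ∑ i, extend 1 (channelOf h j i) * V k i =
        Matrix.of fun x y => (W j * T h j) (σ j + 1, x) (σ k + 1, y) := by
      ext x y
      simp [Q, V, T, Matrix.mul_apply, Matrix.sum_apply, Fintype.sum_prod_type, extend, ite_and]
    rw [this, hW]
    ext x y
    by_cases hjk : j = k <;> simp [hjk, Matrix.one_apply]
  refine ⟨V, Q, fun k => ?_, fun j k hkj => ?_, fun j => ?_⟩
  · ext x y
    simp [V]
  · rw [key, if_neg (Ne.symm hkj)]
  · have hdet : (L * T h j).det ≠ 0 := (Finset.prod_ne_zero_iff.1 hh) j (Finset.mem_univ j)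
    rw [key, if_pos rfl, Matrix.isUnit_iff_isUnit_det]
    simp [hdet]

/-- The three cyclic shifts form a Latin square, so every receiver meets every group once. -/
theorem threePhaseNeutralization_of_forall {M N n s : ℕ} {H : Channel M N}
    (h : ∀ σ, NeutralizingPhase H n s σ) : ThreePhaseNeutralization H n s := by
  refine ⟨fun φ => Equiv.addLeft φ, fun k => ?_, fun φ => h _⟩
  exact (Equiv.addRight k).bijective

/-- Linear interference neutralization attains `d02`. -/
theorem exists_ae_threePhaseNeutralization (M N : ℕ) (hM : 0 < M) :
    ∃ n s : ℕ, 0 < n ∧ (s : ℝ) / n = d02 M N ∧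
      ∀ (μ : Measure ℂ) [IsProbabilityMeasure μ] [NullSingletonClass μ],
        ∀ᵐ h ∂channelLaw M N μ, ThreePhaseNeutralization (channelOf h) n s := by
  have hM' : (0 : ℝ) < M := by exact_mod_cast hM
  suffices h : ∃ n s : ℕ, 0 < n ∧ (s : ℝ) / n = d02 M N ∧
      ∀ (σ : Equiv.Perm (Fin 3)) (μ : Measure ℂ) [IsProbabilityMeasure μ] [NullSingletonClass μ],
        ∀ᵐ h ∂channelLaw M N μ, NeutralizingPhase (channelOf h) n s σ by
    obtain ⟨n, s, hn, hs, hae⟩ := h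
    refine ⟨n, s, hn, hs, fun μ _ _ => ?_⟩
    filter_upwards [ae_all_iff.2 fun σ => hae σ μ] with h hh
    exact threePhaseNeutralization_of_forall hh
  have hdiv : ∀ a b : ℕ, 0 < b → ((N : ℝ) / M ≤ a / b ↔ b * N ≤ a * M) := by
    intro a b hb
    have hb' : (0 : ℝ) < b := by exact_mod_cast hb
    rw [div_le_div_iff₀ hM' hb']
    norm_cast
    rw [mul_comm N b]
  have h1 := hdiv 2 3 (by norm_num)
  have h2 := hdiv 5 3 (by norm_num)
  have h3 := hdiv 5 2 (by norm_num)
  push_cast at h1 h2 h3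
  unfold d02
  by_cases c1 : 3 * N ≤ 2 * M
  · rw [if_pos (h1.2 c1)]
    exact ⟨1, N, one_pos, by simp, fun σ μ _ _ =>
      (ControllableDims.of_le_two_thirds c1).ae_neutralizingPhase σ μ⟩
  rw [if_neg (mt h1.1 c1)]
  by_cases c2 : 3 * N ≤ 5 * M
  · rw [if_pos (h2.2 c2)]
    exact ⟨3, 2 * M, by norm_num, by push_cast; ring, fun σ μ _ _ =>
      (ControllableDims.of_two_thirds_le (by omega)).ae_neutralizingPhase σ μ⟩
  rw [if_neg (mt h2.1 c2)]
  by_cases c3 : 2 * N ≤ 5 * M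
  · rw [if_pos (h3.2 c3)]
    exact ⟨5, N + (N + 0), by norm_num, by push_cast; ring, fun σ μ _ _ =>
      (AlignableDims.of_five_thirds_le (by omega) c3).ae_neutralizingPhase σ μ⟩
  rw [if_neg (mt h3.1 c3)]
  refine ⟨1, M, one_pos, by simp, fun σ μ _ _ => ?_⟩
  by_cases c4 : N ≤ 3 * M
  · have := (AlignableDims.of_five_halves_le (by omega) c4).ae_neutralizingPhase σ μ
    convert this using 3
    omega
  · exact ae_neutralizingPhase_of_three_mul_le (by omega) σ μ

/-! ### From three phases to one linear scheme -/

/-- A linear scheme over `L` channel uses, which conveys `s` symbols per message without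
interference. -/
structure LinearScheme {M N : ℕ} (H : Channel M N) (L s : ℕ) where
  /-- precoding matrices for the message of group `g` to receiver `k` -/
  pre : (k g i : Fin 3) → Fin L → Matrix (Fin M) (Fin s) ℂ
  /-- combining matrices -/
  comb : (j g : Fin 3) → Fin L → Matrix (Fin s) (Fin N) ℂ
  pre_self : ∀ k g, pre k g g = 0
  comb_mul : ∀ j g k g', ∑ t, comb j g t * ∑ i, H j i * pre k g' i t =
    if j = k ∧ g = g' then 1 else 0

/-- The phases occupy disjoint times and hence do not interact. The message of group `g` for
receiver `k` lives in the unique phase `φ` with `σ φ k = g`, and `W` normalizes the desired streams.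
-/
theorem ThreePhaseNeutralization.exists_linearScheme {M N n s : ℕ} {H : Channel M N}
    (h : ThreePhaseNeutralization H n s) : Nonempty (LinearScheme H (3 * n) s) := by
  obtain ⟨σ, hσ, hph⟩ := h
  choose V Q hV hQ0 hQ1 using hph
  have hQ2 : ∀ φ j, ∃ W : Matrix (Fin s) (Fin s) ℂ,
      W * (Q φ j * ∑ i, extend n (H j i) * V φ j i) = 1 := fun φ j =>
    (hQ1 φ j).exists_left_inv
  choose W hW using hQ2
  have key : ∀ φ j k, W φ j * (Q φ j * ∑ i, extend n (H j i) * V φ k i) =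
      if j = k then 1 else 0 := by
    intro φ j k
    split_ifs with hjk
    · subst hjk
      exact hW φ j
    · rw [hQ0 φ j k (Ne.symm hjk), Matrix.mul_zero]
  let e := (finProdFinEquiv (m := 3) (n := n)).symm
  refine ⟨fun k g i t => Matrix.of fun m x => if σ (e t).1 k = g then V (e t).1 k i ((e t).2, m) x
    else 0, fun j g t => Matrix.of fun x a => if σ (e t).1 j = g then
      (W (e t).1 j * Q (e t).1 j) x ((e t).2, a) else 0, fun k g => ?_, fun j g k g' => ?_⟩
  · ext t m x
    by_cases hg : σ (e t).1 k = g
    · simp [← hg, hV]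
    · simp [hg]
  · have hsum : ∀ φ : Fin 3, ∀ x y, ∑ t : Fin n, ∑ a, (W φ j * Q φ j) x (t, a) *
        ∑ i, ∑ m, H j i a m * V φ k i (t, m) y = if j = k then (1 : Matrix _ _ ℂ) x y else 0 := by
      intro φ x y
      have := congrFun (congrFun (key φ j k) x) y
      rw [← Matrix.mul_assoc] at this
      simp only [Matrix.mul_apply (M := W φ j * Q φ j), Matrix.sum_apply,
        Fintype.sum_prod_type] at this
      rw [show (if j = k then (1 : Matrix (Fin s) (Fin s) ℂ) x y else 0) =
        (if j = k then (1 : Matrix (Fin s) (Fin s) ℂ) else 0) x y by split_ifs <;> rfl, ← this]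
      refine Finset.sum_congr rfl fun t _ => Finset.sum_congr rfl fun a _ => ?_
      congr 1
      refine Finset.sum_congr rfl fun i _ => ?_
      rw [Matrix.mul_apply, Fintype.sum_prod_type]
      simp [extend, Matrix.one_apply]
    ext x y
    rw [← e.symm.sum_comp, Fintype.sum_prod_type, Matrix.sum_apply]
    have hφ : ∀ φ, (∑ t, (Matrix.of fun x a => if σ (e (e.symm (φ, t))).1 j = g then
          (W (e (e.symm (φ, t))).1 j * Q (e (e.symm (φ, t))).1 j) x ((e (e.symm (φ, t))).2, a)
          else 0) * ∑ i, H j i * Matrix.of fun m x =>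
          if σ (e (e.symm (φ, t))).1 k = g' then
          V (e (e.symm (φ, t))).1 k i ((e (e.symm (φ, t))).2, m) x else 0) x y =
        if σ φ j = g ∧ σ φ k = g' then (if j = k then (1 : Matrix _ _ ℂ) x y else 0) else 0 := by
      intro φ
      rw [← hsum φ x y]
      by_cases h1 : σ φ j = g <;> by_cases h2 : σ φ k = g' <;>
      simp [h1, h2, Matrix.mul_apply, Matrix.sum_apply]
    rw [Finset.sum_congr rfl fun φ _ => hφ φ]
    obtain ⟨φ₀, hφ₀⟩ := (hσ j).2 g
    have hu : ∀ φ, σ φ j = g ↔ φ = φ₀ := fun φ =>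
      ⟨fun h => (hσ j).1 (h.trans hφ₀.symm), fun h => h ▸ hφ₀⟩
    by_cases hjk : j = k
    · subst hjk
      by_cases hg : g = g'
      · subst hg
        simp [hu]
      · have : ∀ φ, ¬(σ φ j = g ∧ σ φ j = g') := fun φ h => hg (h.1.symm.trans h.2)
        simp [hg, this]
    · simp [hjk]

/-! ### Outer codes of large Hamming distance -/

section GilbertVarshamov

variable {A : Type*} [Fintype A] [DecidableEq A] [Nonempty A]

/-- A word in the ball is given by the set of positions where it differs from `x`, at most `2 ^ B`
choices, and its letters there. -/
theorem card_hammingBall_le (B d : ℕ) (x : Fin B → A) :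
    (Finset.univ.filter fun y : Fin B → A => hammingDist x y ≤ d).card ≤
      2 ^ B * Fintype.card A ^ d := by
  classical
  let T : Finset (Finset (Fin B)) := Finset.univ.filter fun S => S.card ≤ d
  let P : Finset (Fin B) → Finset (Fin B → A) := fun S =>
    Fintype.piFinset fun b => if b ∈ S then Finset.univ else {x b}
  have hsub : (Finset.univ.filter fun y : Fin B → A => hammingDist x y ≤ d) ⊆ T.biUnion P := by
    intro y hy
    rw [Finset.mem_filter] at hy
    refine Finset.mem_biUnion.2 ⟨Finset.univ.filter fun b => x b ≠ y b, ?_, ?_⟩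
    · simpa [T, hammingDist] using hy.2
    · refine Fintype.mem_piFinset.2 fun b => ?_
      by_cases hb : x b = y b <;> simp [hb]
  refine (Finset.card_le_card hsub).trans (Finset.card_biUnion_le.trans ?_)
  have hP : ∀ S ∈ T, (P S).card ≤ Fintype.card A ^ d := by
    intro S hS
    rw [Fintype.card_piFinset]
    calc ∏ b, (if b ∈ S then (Finset.univ : Finset A) else {x b}).card
        = Fintype.card A ^ S.card := by
          simp [apply_ite Finset.card]
      _ ≤ _ := Nat.pow_le_pow_right Fintype.card_pos (Finset.mem_filter.1 hS).2
  refine (Finset.sum_le_card_nsmul _ _ _ hP).trans ?_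
  rw [smul_eq_mul]
  refine Nat.mul_le_mul_right _ ((Finset.card_le_univ T).trans ?_)
  simp

/-- The Gilbert–Varshamov bound. -/
theorem exists_code (A : Type*) [Fintype A] [DecidableEq A] [Nonempty A] (B d : ℕ) :
    ∃ (K : ℕ) (c : Fin K → Fin B → A), 0 < K ∧
      (∀ w w', hammingDist (c w) (c w') ≤ d → w = w') ∧
      Fintype.card A ^ B ≤ K * (2 ^ B * Fintype.card A ^ d) := by
  classical
  let F : Finset (Finset (Fin B → A)) := Finset.univ.filter fun S =>
    ∀ x ∈ S, ∀ y ∈ S, hammingDist x y ≤ d → x = y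
  obtain ⟨S, hS, hmax⟩ := F.exists_max_image Finset.card ⟨∅, by simp [F]⟩
  have hS' : ∀ x ∈ S, ∀ y ∈ S, hammingDist x y ≤ d → x = y := (Finset.mem_filter.1 hS).2
  have hcov : ∀ y, ∃ x ∈ S, hammingDist x y ≤ d := by
    intro y
    by_contra hy
    push Not at hy
    have hyS : y ∉ S := fun h => absurd (hy y h) (by simp)
    have := hmax (insert y S) (by
      refine Finset.mem_filter.2 ⟨Finset.mem_univ _, fun a ha b hb hab => ?_⟩
      rcases Finset.mem_insert.1 ha with rfl | ha' <;> rcases Finset.mem_insert.1 hb with rfl | hb'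
      · rfl
      · exact absurd hab (not_le.2 (by rw [hammingDist_comm]; exact hy b hb'))
      · exact absurd hab (not_le.2 (hy a ha'))
      · exact hS' a ha' b hb' hab)
    rw [Finset.card_insert_of_notMem hyS] at this
    omega
  have hcard : Fintype.card A ^ B ≤ S.card * (2 ^ B * Fintype.card A ^ d) := by
    have : (Finset.univ : Finset (Fin B → A)) ⊆
        S.biUnion fun x => Finset.univ.filter fun y => hammingDist x y ≤ d := by
      intro y _
      obtain ⟨x, hx, hxy⟩ := hcov y
      exact Finset.mem_biUnion.2 ⟨x, hx, by simpa using hxy⟩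
    have h1 := (Finset.card_le_card this).trans (Finset.card_biUnion_le.trans
      (Finset.sum_le_card_nsmul _ _ _ fun x _ => card_hammingBall_le B d x))
    simpa using h1
  refine ⟨S.card, fun w => (S.equivFin.symm w : Fin B → A), ?_, fun w w' h => ?_, hcard⟩
  · obtain ⟨x, hx, -⟩ := hcov fun _ => Classical.arbitrary A
    exact Finset.card_pos.2 ⟨x, hx⟩
  · exact S.equivFin.symm.injective (Subtype.ext (hS' _ (S.equivFin.symm w).2 _
      (S.equivFin.symm w').2 h))

end GilbertVarshamov

/-! ### Rare large noise -/

/-- The probability that the noise in one channel use exceeds `ρ`. -/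
noncomputable def noiseTail (N : ℕ) (ρ : ℝ) : ℝ :=
  (Measure.pi fun _ : Fin N => complexGaussian).real {x | ρ < ‖x‖}

theorem tendsto_noiseTail (N : ℕ) : Tendsto (noiseTail N) atTop (𝓝 0) := by
  have h := tendsto_measure_compl_closedBall_of_isTightMeasureSet
    (isTightMeasureSet_singleton (μ := Measure.pi fun _ : Fin N => complexGaussian)) 0
  simp only [Set.mem_singleton_iff, iSup_iSup_eq_left] at h
  have h2 := (ENNReal.tendsto_toReal ENNReal.zero_ne_top).comp h
  refine h2.congr fun ρ => ?_
  simp only [noiseTail, Measure.real, Function.comp]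
  congr 2
  ext x
  simp

/-- Large noise is unlikely to occur often. -/
theorem noiseLaw_many_le (N T m : ℕ) (ρ : ℝ) :
    (noiseLaw N T).real {z | m ≤ (Finset.univ.filter fun t => ρ < ‖z t‖).card} ≤
      2 ^ T * noiseTail N ρ ^ m := by
  classical
  let U : Finset (Finset (Fin T)) := Finset.powersetCard m Finset.univ
  have hsub : {z : Fin T → Fin N → ℂ | m ≤ (Finset.univ.filter fun t => ρ < ‖z t‖).card} ⊆
      ⋃ S ∈ U, (S : Set (Fin T)).pi fun _ => {x | ρ < ‖x‖} := by
    intro z hz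
    obtain ⟨S, hS, hc⟩ := Finset.exists_subset_card_eq hz
    refine Set.mem_iUnion₂.2 ⟨S, Finset.mem_powersetCard.2 ⟨Finset.subset_univ _, hc⟩, ?_⟩
    intro t ht
    exact (Finset.mem_filter.1 (hS ht)).2
  refine (measureReal_mono hsub (measure_ne_top _ _)).trans
    ((measureReal_biUnion_finset_le _ _).trans ?_)
  have hS : ∀ S ∈ U, (noiseLaw N T).real ((S : Set (Fin T)).pi fun _ => {x | ρ < ‖x‖}) ≤
      noiseTail N ρ ^ m := by
    intro S hS
    rw [noiseLaw, Measure.real, Measure.pi_pi_finset, Finset.prod_const,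
      (Finset.mem_powersetCard.1 hS).2, ENNReal.toReal_pow]
    rfl
  refine (Finset.sum_le_card_nsmul _ _ _ hS).trans ?_
  rw [nsmul_eq_mul]
  refine mul_le_mul_of_nonneg_right ?_ (pow_nonneg measureReal_nonneg _)
  have : U.card ≤ 2 ^ T := by
    rw [Finset.card_powersetCard, Finset.card_univ, Fintype.card_fin]
    exact Nat.choose_le_two_pow T m
  exact_mod_cast this

/-! ### Square constellations and rounding -/

/-- The complex symbols of a square constellation with spacing `Δ`. -/
noncomputable def symbol {s q : ℕ} (Δ : ℝ) (α : Fin s → Fin q × Fin q) : Fin s → ℂ :=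
  fun x => ⟨Δ * (α x).1, Δ * (α x).2⟩

/-- Rounding to the nearest point of the square lattice with spacing `Δ`. -/
noncomputable def roundSymbol {s : ℕ} (Δ : ℝ) (y : Fin s → ℂ) : Fin s → ℤ × ℤ :=
  fun x => (round ((y x).re / Δ), round ((y x).im / Δ))

/-- The lattice point of a symbol. -/
def latticePoint {s q : ℕ} (α : Fin s → Fin q × Fin q) : Fin s → ℤ × ℤ :=
  fun x => (((α x).1 : ℕ), ((α x).2 : ℕ))

theorem latticePoint_injective {s q : ℕ} :
    Function.Injective (latticePoint : (Fin s → Fin q × Fin q) → _) := by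
  intro α β h
  funext x
  have := congrFun h x
  simp only [latticePoint, Prod.mk.injEq, Nat.cast_inj] at this
  exact Prod.ext (Fin.ext this.1) (Fin.ext this.2)

theorem norm_symbol_le {s q : ℕ} {Δ : ℝ} (hΔ : 0 ≤ Δ) (α : Fin s → Fin q × Fin q) :
    ‖symbol Δ α‖ ≤ 2 * Δ * q := by
  refine (pi_norm_le_iff_of_nonneg (by positivity)).2 fun x => ?_
  refine (Complex.norm_le_abs_re_add_abs_im _).trans ?_
  have h1 : ((α x).1 : ℝ) ≤ q := by exact_mod_cast (α x).1.2.le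
  have h2 : ((α x).2 : ℝ) ≤ q := by exact_mod_cast (α x).2.2.le
  have h3 := mul_le_mul_of_nonneg_left h1 hΔ
  have h4 := mul_le_mul_of_nonneg_left h2 hΔ
  simp only [symbol]
  rw [abs_of_nonneg (by positivity), abs_of_nonneg (by positivity)]
  linarith

theorem round_eq_of_abs_lt {Δ r a : ℝ} (hΔ : 0 < Δ) (n : ℕ) (h : a = Δ * n + r) (hr : |r| < Δ / 2) :
    round (a / Δ) = (n : ℤ) := by
  rw [round_eq_iff, Set.mem_Ico, le_div_iff₀ hΔ, div_lt_iff₀ hΔ]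
  have := abs_lt.1 hr
  push_cast
  constructor <;> nlinarith

theorem roundSymbol_eq {s q : ℕ} {Δ : ℝ} (hΔ : 0 < Δ) (α : Fin s → Fin q × Fin q)
    {y v : Fin s → ℂ} (h : y = symbol Δ α + v) (hv : ‖v‖ < Δ / 2) :
    roundSymbol Δ y = latticePoint α := by
  subst h
  funext x
  have hx : ‖v x‖ < Δ / 2 := (norm_le_pi_norm v x).trans_lt hv
  refine Prod.ext ?_ ?_
  · exact round_eq_of_abs_lt hΔ _ (by simp [symbol])
      ((Complex.abs_re_le_norm _).trans_lt hx)
  · exact round_eq_of_abs_lt hΔ _ (by simp [symbol])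
      ((Complex.abs_im_le_norm _).trans_lt hx)

theorem measurable_roundSymbol {s : ℕ} (Δ : ℝ) :
    Measurable (roundSymbol Δ : (Fin s → ℂ) → _) := by
  refine measurable_pi_iff.2 fun x => ?_
  have hr : Measurable (round : ℝ → ℤ) := by
    have : (round : ℝ → ℤ) = fun x => ⌊x + 1 / 2⌋ := funext round_eq
    rw [this]
    exact Int.measurable_floor.comp (measurable_id.add_const _)
  exact (hr.comp ((Complex.measurable_re.comp (measurable_pi_apply x)).div_const Δ)).prodMk
    (hr.comp ((Complex.measurable_im.comp (measurable_pi_apply x)).div_const Δ))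

/-! ### Channel codes from a linear scheme -/

namespace LinearScheme

variable {M N L s : ℕ} {H : Channel M N}

/-- The signal sent by transmitter `i` in channel use `t` of a block. -/
noncomputable def signal (S : LinearScheme H L s) (u : Fin 3 → Fin 3 → Fin s → ℂ) (i : Fin 3)
    (t : Fin L) : Fin M → ℂ :=
  ∑ k, ∑ g, S.pre k g i t *ᵥ u k g

/-- The combined signal of receiver `j` for the message of group `g`. -/
noncomputable def combined (S : LinearScheme H L s) (j g : Fin 3) (y : Fin L → Fin N → ℂ) :
    Fin s → ℂ :=
  ∑ t, S.comb j g t *ᵥ y t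

theorem combined_add (S : LinearScheme H L s) (j g : Fin 3) (y z : Fin L → Fin N → ℂ) :
    S.combined j g (fun t => y t + z t) = S.combined j g y + S.combined j g z := by
  simp [combined, Matrix.mulVec_add, Finset.sum_add_distrib]

theorem combined_signal (S : LinearScheme H L s) (u : Fin 3 → Fin 3 → Fin s → ℂ) (j g : Fin 3) :
    S.combined j g (fun t => ∑ i, H j i *ᵥ S.signal u i t) = u j g := by
  have : S.combined j g (fun t => ∑ i, H j i *ᵥ S.signal u i t) =
      ∑ k, ∑ g', (∑ t, S.comb j g t * ∑ i, H j i * S.pre k g' i t) *ᵥ u k g' := by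
    simp only [combined, signal, Matrix.mulVec_sum, Matrix.sum_mulVec, Matrix.mulVec_mulVec,
      Matrix.mul_sum]
    simp only [Fin.sum_univ_three (M := Fin s → ℂ), Finset.sum_add_distrib]
    abel
  simp only [this, S.comb_mul]
  rw [Finset.sum_eq_single j, Finset.sum_eq_single g]
  · simp
  · intro g' _ hg
    simp [Ne.symm hg]
  · simp
  · intro k _ hk
    simp [Ne.symm hk]
  · simp

theorem signal_congr (S : LinearScheme H L s) {u u' : Fin 3 → Fin 3 → Fin s → ℂ} {i : Fin 3}
    (h : ∀ k g, g ≠ i → u k g = u' k g) (t : Fin L) : S.signal u i t = S.signal u' i t := by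
  refine Finset.sum_congr rfl fun k _ => Finset.sum_congr rfl fun g _ => ?_
  by_cases hg : g = i
  · subst hg
    simp [S.pre_self]
  · rw [h k g hg]

theorem exists_signal_bound (S : LinearScheme H L s) :
    ∃ C : ℝ, 0 < C ∧ ∀ u i t, ∑ m, ‖S.signal u i t m‖ ^ 2 ≤ (C * ‖u‖) ^ 2 := by
  let f : (Fin 3 → Fin 3 → Fin s → ℂ) →ₗ[ℂ] (Fin 3 → Fin L → Fin M → ℂ) :=
    { toFun := fun u i t => S.signal u i t
      map_add' := fun u v => by
        ext i t m
        simp [signal, Matrix.mulVec_add, Finset.sum_add_distrib]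
      map_smul' := fun c u => by
        ext i t m
        simp [signal, Matrix.mulVec_smul, Finset.mul_sum] }
  let F := LinearMap.toContinuousLinearMap f
  refine ⟨Real.sqrt M * ‖F‖ + 1, by positivity, fun u i t => ?_⟩
  have h1 : ∀ m, ‖S.signal u i t m‖ ≤ ‖F‖ * ‖u‖ := fun m =>
    ((norm_le_pi_norm (f u i t) m).trans ((norm_le_pi_norm (f u i) t).trans
      (norm_le_pi_norm (f u) i))).trans (F.le_opNorm u)
  calc ∑ m, ‖S.signal u i t m‖ ^ 2 ≤ ∑ _m : Fin M, (‖F‖ * ‖u‖) ^ 2 :=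
        Finset.sum_le_sum fun m _ => pow_le_pow_left₀ (norm_nonneg _) (h1 m) 2
    _ = (Real.sqrt M * ‖F‖ * ‖u‖) ^ 2 := by
        rw [Finset.sum_const, Finset.card_univ, Fintype.card_fin, nsmul_eq_mul, mul_assoc,
          mul_pow (Real.sqrt M), Real.sq_sqrt (Nat.cast_nonneg M)]
    _ ≤ _ := by
        refine pow_le_pow_left₀ (by positivity) ?_ 2
        exact mul_le_mul_of_nonneg_right (by linarith) (norm_nonneg u)

theorem exists_combined_bound (S : LinearScheme H L s) :
    ∃ C : ℝ, 0 < C ∧ ∀ j g z, ‖S.combined j g z‖ ≤ C * ‖z‖ := by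
  let f : (Fin L → Fin N → ℂ) →ₗ[ℂ] (Fin 3 → Fin 3 → Fin s → ℂ) :=
    { toFun := fun z j g => S.combined j g z
      map_add' := fun u v => by
        ext j g m
        simp [combined, Matrix.mulVec_add, Finset.sum_add_distrib]
      map_smul' := fun c u => by
        ext j g m
        simp [combined, Matrix.mulVec_smul, Finset.mul_sum] }
  let F := LinearMap.toContinuousLinearMap f
  refine ⟨‖F‖ + 1, by positivity, fun j g z => ?_⟩
  have h1 : ‖S.combined j g z‖ ≤ ‖F‖ * ‖z‖ :=
    ((norm_le_pi_norm (f z j) g).trans (norm_le_pi_norm (f z) j)).trans (F.le_opNorm z)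
  exact h1.trans (mul_le_mul_of_nonneg_right (by linarith) (norm_nonneg z))

theorem measurable_combined (S : LinearScheme H L s) (j g : Fin 3) :
    Measurable (S.combined j g) := by
  refine Continuous.measurable ?_
  unfold combined
  fun_prop

/-- The channel use `t` of the block `b`. -/
def blockIndex {B T : ℕ} (hT : L * B ≤ T) (b : Fin B) (t : Fin L) : Fin T :=
  ⟨L * b + t, by
    have h1 : L * (b + 1) ≤ L * B := Nat.mul_le_mul_left L b.2
    have h2 := t.2
    rw [mul_add] at h1
    omega⟩

theorem blockIndex_div {B T : ℕ} (hT : L * B ≤ T) (b : Fin B) (t : Fin L) :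
    (blockIndex hT b t : ℕ) / L = b := by
  have := t.2
  simp only [blockIndex]
  rw [Nat.mul_add_div (by omega), Nat.div_eq_of_lt t.2, add_zero]

theorem blockIndex_mod {B T : ℕ} (hT : L * B ≤ T) (b : Fin B) (t : Fin L) :
    (blockIndex hT b t : ℕ) % L = t := by
  simp only [blockIndex]
  rw [Nat.mul_add_mod, Nat.mod_eq_of_lt t.2]

/-- A linear scheme together with an outer code that corrects `m` symbol errors gives a code for
the channel. Rounding is correct in all blocks where the noise stays below `ρ`. -/
theorem exists_code (S : LinearScheme H L s) (hL : 0 < L) {C₁ C₂ Δ ρ P : ℝ} {q B T : ℕ} (m : ℕ)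
    (h₁ : ∀ u i t, ∑ a, ‖S.signal u i t a‖ ^ 2 ≤ (C₁ * ‖u‖) ^ 2) (hC₁ : 0 ≤ C₁)
    (h₂ : ∀ j g z, ‖S.combined j g z‖ ≤ C₂ * ‖z‖) (hC₂ : 0 ≤ C₂) (hΔ : 0 < Δ) (hρ : 0 ≤ ρ)
    (hq : 0 < q) (hP : (C₁ * (2 * Δ * q)) ^ 2 ≤ P) (hρΔ : C₂ * ρ < Δ / 2) (hT : L * B ≤ T) :
    ∃ C : Code M N T P,
      (∀ k g, (q ^ (2 * s)) ^ B ≤ C.K k g * (2 ^ B * (q ^ (2 * s)) ^ (2 * m))) ∧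
      ∀ j, C.errorProb H j ≤ 2 ^ T * noiseTail N ρ ^ (m + 1) := by
  classical
  have : NeZero q := ⟨hq.ne'⟩
  obtain ⟨K, c, hK, hc, hcard⟩ := CoopX.exists_code (Fin s → Fin q × Fin q) B (2 * m)
  let u : Messages (fun _ _ => K) → Fin B → Fin 3 → Fin 3 → Fin s → ℂ :=
    fun w b k g => symbol Δ (c (w k g) b)
  have hu : ∀ w b, ‖u w b‖ ≤ 2 * Δ * q := fun w b =>
    (pi_norm_le_iff_of_nonneg (by positivity)).2 fun k =>
      (pi_norm_le_iff_of_nonneg (by positivity)).2 fun g => norm_symbol_le hΔ.le _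
  let enc : Fin 3 → Messages (fun _ _ => K) → Fin T → Fin M → ℂ := fun i w t =>
    if h : (t : ℕ) / L < B then S.signal (u w ⟨t / L, h⟩) i ⟨t % L, Nat.mod_lt _ hL⟩ else 0
  have henc : ∀ i w b t, enc i w (blockIndex hT b t) = S.signal (u w b) i t := by
    intro i w b t
    have hb : (⟨(blockIndex hT b t : ℕ) / L, by rw [blockIndex_div]; exact b.2⟩ : Fin B) = b :=
      Fin.ext (blockIndex_div hT b t)
    have ht : (⟨(blockIndex hT b t : ℕ) % L, Nat.mod_lt _ hL⟩ : Fin L) = t :=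
      Fin.ext (blockIndex_mod hT b t)
    have hlt : (blockIndex hT b t : ℕ) / L < B := by rw [blockIndex_div]; exact b.2
    simp only [enc, dif_pos hlt, hb, ht]
  let word : (j g : Fin 3) → (Fin T → Fin N → ℂ) → Fin B → Fin s → ℤ × ℤ := fun j g y b =>
    roundSymbol Δ (S.combined j g fun t => y (blockIndex hT b t))
  let lat : Fin K → Fin B → Fin s → ℤ × ℤ := fun w b => latticePoint (c w b)
  -- Distinct codewords differ in more than `2 * m` blocks, so at most one lies within distance `m`.
  -- The default value is used only when there are too many errors.
  let decide : (Fin B → Fin s → ℤ × ℤ) → Fin K := fun r =>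
    if h : ∃ w, hammingDist (lat w) r ≤ m then h.choose else ⟨0, hK⟩
  have hdecide : ∀ w r, hammingDist (lat w) r ≤ m → decide r = w := by
    intro w r hw
    have hex : ∃ w, hammingDist (lat w) r ≤ m := ⟨w, hw⟩
    have hch := hex.choose_spec
    simp only [decide, dif_pos hex]
    refine hc _ _ ?_
    rw [← hammingDist_comp (fun _ => latticePoint) fun _ => latticePoint_injective]
    have := hammingDist_triangle_right (lat hex.choose) (lat w) r
    change hammingDist (lat hex.choose) (lat w) ≤ 2 * m
    omega
  have hmeas : ∀ k, Measurable fun (y : Fin T → Fin N → ℂ) g => decide (word k g y) := by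
    intro k
    refine measurable_pi_iff.2 fun g => (measurable_of_countable decide).comp ?_
    refine measurable_pi_iff.2 fun b => (measurable_roundSymbol Δ).comp
      ((S.measurable_combined k g).comp ?_)
    exact measurable_pi_iff.2 fun t => measurable_pi_apply _
  let C : Code M N T P :=
    { K := fun _ _ => K
      K_pos := fun _ _ => hK
      enc := enc
      enc_local := fun i w w' hww => by
        funext t
        simp only [enc]
        split_ifs with h
        · exact S.signal_congr (fun k g hg => by simp only [u, hww k g hg]) _
        · rfl
      power := fun i w t => by
        simp only [enc]
        split_ifs with h
        · refine (h₁ _ _ _).trans (le_trans ?_ hP)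
          exact pow_le_pow_left₀ (by positivity) (mul_le_mul_of_nonneg_left (hu _ _) hC₁) 2
        · simpa using (sq_nonneg _).trans hP
      dec := fun k y g => decide (word k g y)
      dec_measurable := hmeas }
  refine ⟨C, fun k g => ?_, fun j => ?_⟩
  · have : Fintype.card (Fin s → Fin q × Fin q) = q ^ (2 * s) := by
      simp [← pow_two, ← pow_mul]
    rw [this] at hcard
    exact hcard
  have hgood : ∀ (w : Messages C.K) (z : Fin T → Fin N → ℂ),
      (Finset.univ.filter fun t => ρ < ‖z t‖).card ≤ m → C.dec j (C.output H w j z) = w j := by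
    intro w z hz
    funext g
    refine hdecide _ _ (le_trans ?_ hz)
    have hblock : ∀ b, (∀ t, ‖z (blockIndex hT b t)‖ ≤ ρ) →
        lat (w j g) b = word j g (C.output H w j z) b := by
      intro b hb
      symm
      have hcomb : (S.combined j g fun t => C.output H w j z (blockIndex hT b t)) =
          symbol Δ (c (w j g) b) + S.combined j g fun t => z (blockIndex hT b t) := by
        have h3 : (fun t => C.output H w j z (blockIndex hT b t)) = fun t =>
            (∑ i, H j i *ᵥ S.signal (u w b) i t) + z (blockIndex hT b t) := by
          funext t
          simp only [Code.output, C, henc]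
        rw [h3, S.combined_add j g (fun t => ∑ i, H j i *ᵥ S.signal (u w b) i t),
          S.combined_signal]
      refine roundSymbol_eq hΔ _ hcomb ?_
      refine (h₂ _ _ _).trans_lt (lt_of_le_of_lt ?_ hρΔ)
      exact mul_le_mul_of_nonneg_left ((pi_norm_le_iff_of_nonneg hρ).2 hb) hC₂
    -- Each wrong block contains a channel use with large noise, so there are no more wrong blocks
    -- than such channel uses.
    have hsub : (Finset.univ.filter fun b : Fin B =>
          lat (w j g) b ≠ word j g (C.output H w j z) b).image Fin.val ⊆
        (Finset.univ.filter fun t => ρ < ‖z t‖).image fun t : Fin T => (t : ℕ) / L := by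
      intro x hx
      obtain ⟨b, hb, rfl⟩ := Finset.mem_image.1 hx
      have hb' := mt (hblock b) (Finset.mem_filter.1 hb).2
      push Not at hb'
      obtain ⟨t, ht⟩ := hb'
      exact Finset.mem_image.2 ⟨blockIndex hT b t, by simpa using ht, blockIndex_div hT b t⟩
    have hcard := (Finset.card_le_card hsub).trans Finset.card_image_le
    rwa [Finset.card_image_of_injective _ Fin.val_injective] at hcard
  have hw : ∀ w : Messages C.K, (noiseLaw N T).real {z | C.dec j (C.output H w j z) ≠ w j} ≤
      2 ^ T * noiseTail N ρ ^ (m + 1) := by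
    intro w
    refine (measureReal_mono ?_ (measure_ne_top _ _)).trans (noiseLaw_many_le N T (m + 1) ρ)
    intro z hz
    by_contra hlt
    exact hz (hgood w z (by simpa [Nat.lt_succ_iff] using hlt))
  have hcard : (0 : ℝ) < Fintype.card (Messages C.K) := by
    have : Nonempty (Messages C.K) := ⟨fun _ _ => ⟨0, hK⟩⟩
    exact_mod_cast Fintype.card_pos
  rw [Code.errorProb, div_le_iff₀ hcard]
  refine (Finset.sum_le_card_nsmul _ _ _ fun w _ => hw w).trans ?_
  rw [nsmul_eq_mul, Finset.card_univ, mul_comm]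

end LinearScheme

/-! ### Rates at high power and the limit -/

/-- Budget for the gap `γ = s - δ * L`. The outer code loses a fraction `2 / a` of the rate and the
smaller constellation `1 / a`; together these cost at most `γ / 2`. A quarter of `γ` pays for the
constant losses (the floor in `q` and the factor `2 ^ B`), and the last quarter for the incomplete
final block. -/
theorem rate_bound {s a m B q K : ℕ} {P δ L : ℝ} {T : ℕ} (hs : 0 ≤ δ * L) (hδ : 0 ≤ δ) (hP : 1 ≤ P)
    (ha : 0 < a) (hγ : 6 * (s : ℝ) ≤ a * (s - δ * L)) (hγ0 : 0 < s - δ * L)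
    (hq : (q : ℝ) = ⌊P ^ ((1 - 1 / (a : ℝ)) / 2)⌋₊)
    (hm : a * m ≤ B) (hK : (q ^ (2 * s)) ^ B ≤ K * (2 ^ B * (q ^ (2 * s)) ^ (2 * m)))
    (hlog : 2 * s + 1 ≤ (s - δ * L) / 4 * Real.logb 2 P) (hB : L * δ ≤ B * ((s - δ * L) / 4))
    (hT : (T : ℝ) ≤ L * (B + 1)) : (2 : ℝ) ^ ((T : ℝ) * (δ * Real.logb 2 P)) ≤ K := by
  set γ := s - δ * L with hγd
  set lam := Real.logb 2 P with hlam
  have hlam0 : 0 ≤ lam := Real.logb_nonneg one_lt_two hP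
  have ha' : (0 : ℝ) < a := by exact_mod_cast ha
  have hs0 : (0 : ℝ) ≤ s := Nat.cast_nonneg s
  have ha6 : (6 : ℝ) ≤ a := by
    by_contra hlt
    push Not at hlt
    have h1 : γ ≤ s := by linarith
    nlinarith
  have hinv : 1 / (a : ℝ) ≤ 1 / 6 := one_div_le_one_div_of_le (by norm_num) ha6
  have hinv0 : 0 < 1 / (a : ℝ) := by positivity
  set x := P ^ ((1 - 1 / (a : ℝ)) / 2) with hx
  have hx1 : 1 ≤ x := Real.one_le_rpow hP (by linarith)
  have hq1 : (1 : ℝ) ≤ q := by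
    rw [hq]
    exact_mod_cast Nat.le_floor (by simpa using hx1)
  have hqx : x / 2 ≤ q := by
    have := Nat.lt_floor_add_one x
    rw [← hq] at this
    linarith
  have hqpos : (0 : ℝ) < q := by linarith
  have hl : (1 - 1 / (a : ℝ)) / 2 * lam - 1 ≤ Real.logb 2 q := by
    have h1 : Real.logb 2 (x / 2) = (1 - 1 / (a : ℝ)) / 2 * lam - 1 := by
      rw [Real.logb_div (by positivity) (by norm_num), hx,
        Real.logb_rpow_eq_mul_logb_of_pos (by linarith), Real.logb_self_eq_one one_lt_two]
    rw [← h1]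
    exact Real.logb_le_logb_of_le one_lt_two (by positivity) hqx
  set l := Real.logb 2 q with hld
  have hl0 : 0 ≤ l := Real.logb_nonneg one_lt_two hq1
  have hKR : ((q : ℝ) ^ (2 * s)) ^ B ≤ K * (2 ^ B * ((q : ℝ) ^ (2 * s)) ^ (2 * m)) := by
    exact_mod_cast hK
  have hKpos : (0 : ℝ) < K := by
    have : (0 : ℝ) < ((q : ℝ) ^ (2 * s)) ^ B := by positivity
    by_contra h0
    have : (K : ℝ) = 0 := le_antisymm (not_lt.1 h0) (Nat.cast_nonneg K)
    rw [this, zero_mul] at hKR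
    linarith
  have hlogK : B * (2 * s * l) ≤ Real.logb 2 K + (B + 2 * m * (2 * s * l)) := by
    have := Real.logb_le_logb_of_le one_lt_two (by positivity) hKR
    rw [Real.logb_mul hKpos.ne' (by positivity), Real.logb_mul (by positivity) (by positivity),
      Real.logb_pow, Real.logb_pow, Real.logb_pow, Real.logb_pow, Real.logb_pow,
      Real.logb_self_eq_one one_lt_two] at this
    push_cast at this
    linarith
  rw [← Real.le_logb_iff_rpow_le one_lt_two hKpos]
  have hm' : (m : ℝ) ≤ B * (1 / a) := by
    rw [mul_one_div, le_div_iff₀ ha', mul_comm]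
    exact_mod_cast hm
  have hB0 : (0 : ℝ) ≤ B := Nat.cast_nonneg B
  have hsl : 0 ≤ 2 * s * l := by positivity
  have e1 : B * ((1 - 2 * (1 / (a : ℝ))) * (2 * s * l) - 1) ≤ Real.logb 2 K := by
    have := mul_le_mul_of_nonneg_right hm' hsl
    linarith
  have e2 : (δ * L + γ / 2) * lam - 2 * s ≤ (1 - 2 * (1 / (a : ℝ))) * (2 * s * l) := by
    have h6 : 3 * s * (1 / (a : ℝ)) ≤ γ / 2 := by
      rw [mul_one_div, div_le_iff₀ ha']
      linarith
    have h7 : s * (1 - 3 * (1 / (a : ℝ))) * lam ≥ (δ * L + γ / 2) * lam :=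
      mul_le_mul_of_nonneg_right (by linarith) hlam0
    have h8 : (1 - 2 * (1 / (a : ℝ))) * (2 * s) * ((1 - 1 / (a : ℝ)) / 2 * lam - 1) ≤
        (1 - 2 * (1 / (a : ℝ))) * (2 * s) * l :=
      mul_le_mul_of_nonneg_left hl (mul_nonneg (by linarith) (by linarith))
    have h9 : 0 ≤ s * lam * (1 / (a : ℝ)) ^ 2 := by positivity
    have h10 : 0 ≤ s * (1 / (a : ℝ)) := by positivity
    have h11 : (1 - 2 * (1 / (a : ℝ))) * (2 * s) * ((1 - 1 / (a : ℝ)) / 2 * lam - 1) =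
        s * (1 - 3 * (1 / (a : ℝ))) * lam + 2 * (s * lam * (1 / (a : ℝ)) ^ 2) - 2 * s +
          4 * (s * (1 / (a : ℝ))) := by ring
    have h12 : (1 - 2 * (1 / (a : ℝ))) * (2 * s * l) = (1 - 2 * (1 / (a : ℝ))) * (2 * s) * l := by
      ring
    linarith
  have e3 : B * ((δ * L + γ / 4) * lam) ≤ Real.logb 2 K := by
    refine le_trans (mul_le_mul_of_nonneg_left ?_ hB0) e1
    linarith
  refine le_trans ?_ e3
  have e4 : (T : ℝ) * δ ≤ B * (δ * L + γ / 4) := by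
    have := mul_le_mul_of_nonneg_right hT hδ
    linarith
  have := mul_le_mul_of_nonneg_right e4 hlam0
  linarith

/-- Here `a` is fixed before `P`. The noise threshold grows like `P ^ (1 / (2 * a))`, so for large
`P` its tail beats the entropy factor `2 ^ (L * a)`, and the error decays geometrically in `m`. -/
theorem LinearScheme.eventually_isAchievableRate {M N L s : ℕ} {H : Channel M N}
    (S : LinearScheme H L s) (hL : 0 < L) {δ : ℝ} (hδ : 0 ≤ δ) (hδs : δ * L < s) :
    ∀ᶠ P in atTop, IsAchievableRate H P fun _ _ => δ * Real.logb 2 P := by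
  obtain ⟨C₁, hC₁, h₁⟩ := S.exists_signal_bound
  obtain ⟨C₂, hC₂, h₂⟩ := S.exists_combined_bound
  have hγ0 : 0 < s - δ * L := by linarith
  obtain ⟨a, ha⟩ := exists_nat_gt (6 * (s : ℝ) / (s - δ * L))
  have hγ : 6 * (s : ℝ) ≤ a * (s - δ * L) := ((div_lt_iff₀ hγ0).1 ha).le
  have ha0 : 0 < a := by
    have : (0 : ℝ) ≤ 6 * (s : ℝ) / (s - δ * L) := by positivity
    exact_mod_cast this.trans_lt ha
  have ha' : (0 : ℝ) < a := by exact_mod_cast ha0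
  have hx0 : (0 : ℝ) < 1 / a / 2 := by positivity
  have hρ : Tendsto (fun P : ℝ => P ^ (1 / (a : ℝ) / 2) / (8 * C₁ * C₂)) atTop atTop :=
    (tendsto_rpow_atTop hx0).atTop_div_const (by positivity)
  have hp : Tendsto (fun P : ℝ => (2 : ℝ) ^ (L * a) *
      noiseTail N (P ^ (1 / (a : ℝ) / 2) / (8 * C₁ * C₂))) atTop (𝓝 0) := by
    have := ((tendsto_noiseTail N).comp hρ).const_mul ((2 : ℝ) ^ (L * a))
    simpa using this
  have hlog : Tendsto (fun P : ℝ => (s - δ * L) / 4 * Real.logb 2 P) atTop atTop :=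
    (Real.tendsto_logb_atTop one_lt_two).const_mul_atTop (by linarith)
  filter_upwards [eventually_ge_atTop 1, hp.eventually_le_const (by norm_num : (0 : ℝ) < 1 / 2),
    hlog.eventually_ge_atTop (2 * s + 1)] with P hP1 hp2 hlogP ε hε
  have hP0 : 0 < P := by linarith
  set p := noiseTail N (P ^ (1 / (a : ℝ) / 2) / (8 * C₁ * C₂)) with hpd
  have hp0 : 0 ≤ p := measureReal_nonneg
  have hTB : Tendsto (fun T : ℕ => T / L) atTop atTop := Nat.tendsto_div_const_atTop hL.ne'
  have hTm : Tendsto (fun T : ℕ => T / L / a + 1) atTop atTop :=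
    (tendsto_add_atTop_nat 1).comp ((Nat.tendsto_div_const_atTop ha0.ne').comp hTB)
  have herr : Tendsto (fun T : ℕ => (2 : ℝ) ^ L * (1 / 2) ^ (T / L / a + 1)) atTop (𝓝 0) := by
    have := ((tendsto_pow_atTop_nhds_zero_of_lt_one (by norm_num : (0 : ℝ) ≤ 1 / 2)
      (by norm_num)).comp hTm).const_mul ((2 : ℝ) ^ L)
    simpa using this
  have hBe : Tendsto (fun T : ℕ => ((T / L : ℕ) : ℝ) * ((s - δ * L) / 4)) atTop atTop :=
    (tendsto_natCast_atTop_atTop.comp hTB).atTop_mul_const (by linarith)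
  refine eventually_atTop.1 ?_
  filter_upwards [herr.eventually_le_const hε, hBe.eventually_ge_atTop (L * δ)] with T hT1 hT2
  set B := T / L with hB
  set m := B / a with hm
  have hTL : L * B ≤ T := Nat.mul_div_le T L
  have hTB' : T ≤ L * (B + 1) := (Nat.lt_mul_div_succ T hL).le
  have hBm : B ≤ a * (m + 1) := (Nat.lt_mul_div_succ B ha0).le
  set x := P ^ ((1 - 1 / (a : ℝ)) / 2) with hx
  have ha1 : 1 / (a : ℝ) ≤ 1 := by
    rw [div_le_one ha']
    exact_mod_cast ha0
  have hx1 : 1 ≤ x := Real.one_le_rpow hP1 (by linarith)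
  have hq0 : 0 < ⌊x⌋₊ := Nat.floor_pos.2 hx1
  set q := ⌊x⌋₊ with hq
  have hqR : (0 : ℝ) < q := by exact_mod_cast hq0
  have hqx : (q : ℝ) ≤ x := Nat.floor_le (by linarith)
  have hsq : Real.sqrt P = x * P ^ (1 / (a : ℝ) / 2) := by
    rw [hx, ← Real.rpow_add hP0, Real.sqrt_eq_rpow]
    congr 1
    ring
  -- `Δ` uses up the full power `P`. Since `q ≤ x`, half the spacing is at least `P ^ (1 / (2 * a))
  -- / (4 * C₁)`; the factor `8` in `ρ` keeps the combined noise strictly below that.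
  obtain ⟨C, hCK, hCe⟩ := S.exists_code hL (Δ := Real.sqrt P / (2 * C₁ * q))
    (ρ := P ^ (1 / (a : ℝ) / 2) / (8 * C₁ * C₂)) (P := P) (q := q) (B := B) (T := T) m h₁ hC₁.le
    h₂ hC₂.le (by positivity) (by positivity) hq0 (by
      have : C₁ * (2 * (Real.sqrt P / (2 * C₁ * q)) * q) = Real.sqrt P := by field_simp
      rw [this, Real.sq_sqrt hP0.le]) (by
      have h3 : C₂ * (P ^ (1 / (a : ℝ) / 2) / (8 * C₁ * C₂)) =
          P ^ (1 / (a : ℝ) / 2) / (8 * C₁) := by field_simp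
      have h4 : P ^ (1 / (a : ℝ) / 2) / (2 * C₁) ≤ Real.sqrt P / (2 * C₁ * q) := by
        rw [div_le_div_iff₀ (by positivity) (by positivity), hsq]
        have : 0 < P ^ (1 / (a : ℝ) / 2) := by positivity
        have := mul_le_mul_of_nonneg_right hqx (mul_pos this (mul_pos two_pos hC₁)).le
        linarith
      rw [h3]
      refine lt_of_lt_of_le ?_ (div_le_div_of_nonneg_right h4 two_pos.le)
      rw [div_div (P ^ _) (2 * C₁) 2]
      refine div_lt_div_of_pos_left (by positivity) (by positivity) ?_
      linarith) hTL
  refine ⟨C, fun k g => ?_, fun j => (hCe j).trans (le_trans ?_ hT1)⟩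
  · exact rate_bound (s := s) (m := m) (by positivity) hδ hP1 ha0 hγ hγ0 rfl (Nat.mul_div_le B a)
      (hCK k g) hlogP hT2 (by exact_mod_cast hTB')
  · have h5 : (2 : ℝ) ^ T ≤ 2 ^ L * ((2 : ℝ) ^ (L * a)) ^ (m + 1) := by
      rw [← pow_mul, ← pow_add]
      refine pow_le_pow_right₀ one_le_two (hTB'.trans ?_)
      have := Nat.mul_le_mul_left L hBm
      linarith
    calc (2 : ℝ) ^ T * p ^ (m + 1) ≤ 2 ^ L * ((2 : ℝ) ^ (L * a)) ^ (m + 1) * p ^ (m + 1) :=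
          mul_le_mul_of_nonneg_right h5 (pow_nonneg hp0 _)
      _ = 2 ^ L * (2 ^ (L * a) * p) ^ (m + 1) := by rw [mul_assoc, mul_pow]
      _ ≤ 2 ^ L * (1 / 2) ^ (m + 1) := by gcongr

/-- If rates `δ * log P` are achievable for all `δ < d`, then so are rates `d * log P + o(log P)`. -/
theorem isAchievableDoF_of_forall_lt {M N : ℕ} {H : Channel M N} {d : ℝ} (hd : 0 < d)
    (h : ∀ δ, 0 ≤ δ → δ < d →
      ∀ᶠ P in atTop, IsAchievableRate H P fun _ _ => δ * Real.logb 2 P) :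
    IsAchievableDoF H fun _ _ => d := by
  classical
  -- Here `δ 0 = 0`, a rate that is achievable for all large `P`; this makes the greatest admissible
  -- index `ν P` meaningful. The cap `⌊P⌋₊` keeps `ν P` finite while still allowing it to tend to
  -- infinity.
  let δ : ℕ → ℝ := fun n => d * (1 - 1 / ((n : ℝ) + 1))
  have hδ : ∀ n, ∀ᶠ P in atTop, IsAchievableRate H P fun _ _ => δ n * Real.logb 2 P := by
    intro n
    have h1 : 0 < 1 / ((n : ℝ) + 1) := by positivity
    have h2 : 1 / ((n : ℝ) + 1) ≤ 1 := by
      rw [div_le_one (by positivity)]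
      linarith [(Nat.cast_nonneg n : (0 : ℝ) ≤ n)]
    exact h _ (mul_nonneg hd.le (by linarith)) (by nlinarith)
  let ν : ℝ → ℕ := fun P =>
    Nat.findGreatest (fun n => IsAchievableRate H P fun _ _ => δ n * Real.logb 2 P) ⌊P⌋₊
  have hν : Tendsto ν atTop atTop := by
    refine tendsto_atTop.2 fun n => ?_
    filter_upwards [hδ n, eventually_ge_atTop (n : ℝ)] with P hP hn
    exact Nat.le_findGreatest (Nat.le_floor hn) hP
  refine ⟨fun P _ _ => δ (ν P) * Real.logb 2 P, ?_, fun k g => ?_⟩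
  · filter_upwards [hδ 0] with P hP
    exact Nat.findGreatest_spec (P := fun n => IsAchievableRate H P fun _ _ =>
      δ n * Real.logb 2 P) (Nat.zero_le _) hP
  · have hlim : Tendsto δ atTop (𝓝 d) := by
      have := (tendsto_one_div_add_atTop_nhds_zero_nat (𝕜 := ℝ)).const_sub 1 |>.const_mul d
      simpa [δ] using this
    refine (hlim.comp hν).congr' ?_
    filter_upwards [eventually_gt_atTop 1] with P hP
    have := (Real.logb_pos one_lt_two hP).ne'
    simp only [Function.comp]
    field_simp

/-- Three-phase neutralization achieves `s / n` degrees of freedom per user. -/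
theorem ThreePhaseNeutralization.isAchievableDoFPerUser {M N n s : ℕ} {H : Channel M N}
    (h : ThreePhaseNeutralization H n s) (hn : 0 < n) (hs : 0 < s) :
    IsAchievableDoFPerUser H ((s : ℝ) / n) := by
  obtain ⟨S⟩ := h.exists_linearScheme
  have hn' : (0 : ℝ) < n := by exact_mod_cast hn
  have hs' : (0 : ℝ) < s := by exact_mod_cast hs
  refine isAchievableDoF_of_forall_lt (by positivity) fun δ hδ0 hδ =>
    S.eventually_isAchievableRate (by omega) hδ0 ?_
  rw [div_div, lt_div_iff₀ (by positivity)] at hδ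
  push_cast
  linarith

end CoopX

theorem lemma1 (M N : ℕ) (hM : 0 < M) (hN : 0 < N) :
    (∀ (μ : Measure ℂ) [IsProbabilityMeasure μ] [NullSingletonClass μ],
      ∀ᵐ h ∂CoopX.channelLaw M N μ,
        CoopX.IsAchievableDoFPerUser (CoopX.channelOf h) (CoopX.d02 M N)) ∧
    ∃ n s : ℕ, 0 < n ∧ (s : ℝ) / n = CoopX.d02 M N ∧
      ∀ (μ : Measure ℂ) [IsProbabilityMeasure μ] [NullSingletonClass μ],
        ∀ᵐ h ∂CoopX.channelLaw M N μ,
          CoopX.ThreePhaseNeutralization (CoopX.channelOf h) n s := by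
  have hM' : (0 : ℝ) < M := by exact_mod_cast hM
  have hN' : (0 : ℝ) < N := by exact_mod_cast hN
  obtain ⟨n, s, hn, hs, hae⟩ := CoopX.exists_ae_threePhaseNeutralization M N hM
  refine ⟨fun μ _ _ => ?_, n, s, hn, hs, hae⟩
  have hs0 : 0 < s := by
    have hd : 0 < CoopX.d02 M N := by
      unfold CoopX.d02
      split_ifs <;> positivity
    refine Nat.pos_of_ne_zero fun h0 => ?_
    rw [h0] at hs
    simp [← hs] at hd
  filter_upwards [hae μ] with h hh
  rw [← hs]
  exact hh.isAchievableDoFPerUser hn hs0
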